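/- **Setting.** Let $X$ be an always observed random element, $Y=(Y_1,\dots,Y_p)$ a random vector subject to missingness and $M=(M_1,\dots,M_p)\in\{0,1\}^p$ its vector of missingness indicators ($M_j=1$ when $Y_j$ is missing). The variables take values in arbitrary measurable spaces with $\sigma$-finite measures $\nu$ (for $X$) and $\mu_j$ (for $Y_j$); $\mu=\bigotimes_j\mu_j$, and full-data densities are densities of $(X,Y,M)$ with respect to $\nu\otimes\mu\otimes$ counting measure. Let $Y_j^*=Y_j$ if $M_j=0$ and $Y_j^*=*$ if $M_j=1$; the observed-data distribution is the law of $(X,Y^*)$, with density $f(x,y^*)=\int f(x,y,m)\,\mu(dy_m)$, where $y_m=(y_j:m_j=1)$. Write $y_{<j},y_{\ge j}$, etc. for subvectors. Let $h(x,y,m)$ be a full-data density with $\pi_j=h(M_j=1)\in(0,1)$ for all $j$. Let $\mathcal U$ be a set of measurable real functions of $y$, integrable under $h(y)$, that contains for each $j$ at least one $h$-almost surely non-constant function of $y_j$; let $\mathcal U_{\ge j}$ be the set of those $u\in\mathcal U$ that depend only on $y_{\ge j}$. Let $\lambda:(0,1)\to\mathbb R$ be differentiable and monotonically increasing, let $c_j=(1-\pi_j)/\pi_j$,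 and suppose that $f_{\lambda,j}(z)=\int_0^z\lambda[v/(c_j+v)]\,dv$ is well defined (the integral converges) and satisfies the growth condition: for every $t>1$ there are $t_0,t_1,t_2,t_3>0$ with $f_{\lambda,j}(tz)\le t_1f_{\lambda,j}(z)+t_2z+t_3$ for all $z>t_0$. For convex $f$, the $f$-divergence is $I_f(P,Q)=\int f(dP/dQ)\,dQ$ for $P\ll Q$ and $+\infty$ otherwise; an $f$-projection of $Q$ onto a set $\mathcal C$ of probability distributions is an element of $\mathcal C$ with finite and minimal divergence from $Q$. **Construction (Algorithm 1).** Start from $g(x,y^*)=h(x,y^*)$ and the values $E[u(Y)]=\int u(y)h(y)\,\mu(dy)$, $u\in\mathcal U$. For $j=p,\dots,1$: (a) from $g(x,y^*_{\le j},y_{>j})$ derive $g(x,y^*_{<j},y_{\ge j}\mid M_j=0)$, $g(x,y^*_{<j},y_{>j}\mid M_j=1)$, $g(y_{\ge j},M_j=0)$ and $\pi_j=g(M_j=1)$; (b) for $u\in\mathcal U_{\ge j}$ put $E_g[u(Y_{\ge j})\mid M_j=1]=\{E[u(Y)]-\int u(y_{\ge j})g(y_{\ge j},M_j=0)\,\mu(dy_{\ge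 j})\}/\pi_j$, the integral being absolutely convergent; (c) let $g(x,y^*_{<j},y_{\ge j}\mid M_j=1)$ be an $f_{\lambda,j}$-projection of $g(x,y^*_{<j},y_{\ge j}\mid M_j=0)$ onto the set of distributions that match the marginal $g(x,y^*_{<j},y_{>j}\mid M_j=1)$ and the expectations $E_g[u(Y_{\ge j})\mid M_j=1]$, $u\in\mathcal U_{\ge j}$; (d) let $g(x,y^*_{<j},y_{\ge j})=\sum_{m_j=0}^1 g(x,y^*_{<j},y_{\ge j}\mid M_j=m_j)\pi_j^{m_j}(1-\pi_j)^{1-m_j}$, and let $g(m_j\mid x,y^*_{<j},y_{\ge j})$ be the quotient of the $m_j$-th summand by the sum. Output $g(x,y,m)=g(x,y)\prod_{j=1}^p g(m_j\mid x,y^*_{<j},y_{\ge j})$. **Theorem 4 (Nonparametric identification).** Let $g(x,y,m)$ be constructed from $h$ by this algorithm (that is, suppose that the integrals in (b) converge and the projections in (c) exist, and let $g$ be the output). Then $g$ is a full-data density, and: 1. $g$ encodes a sequentially additive nonignorable missingness mechanism: for each $j=1,\dots,p$, almost surely under $g$, $g(m_j\mid x,y,m_{<j})=g(m_j\mid x,y^*_{<j},y_{\ge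 j})$ and $g(M_j=1\mid x,y^*_{<j},y_{\ge j})<1$, and there are real-valued functions $\alpha_j,\beta_j$ with $$\lambda\{g(M_j=1\mid x,y^*_{<j},y_{\ge j})\}=\alpha_j(x,y^*_{<j},y_{>j})+\beta_j(y_{\ge j})$$ almost surely where $g(M_j=1\mid x,y^*_{<j},y_{\ge j})>0$ (i.e. where the left side is defined). Moreover $\lambda[g(M_j=1\mid x,y^*_{<j},y_{\ge j})]$ belongs to the closure of the linear span $\langle L_1\{g(x,y^*_{<j},y_{>j}\mid M_j=1)\}\cup\mathcal U_{\ge j}\rangle$ in $L_1\{g(x,y^*_{<j},y_{\ge j}\mid M_j=1)\}$. 2. $g$ and $h$ are observationally equivalent: the laws of $(X,Y^*)$ under $g$ and $h$ coincide, that is $g(x,y^*)=h(x,y^*)$ almost surely; and every $u\in\mathcal U$ is integrable under $g(y)$ with $\int u(y)g(y)\,\mu(dy)=\int u(y)h(y)\,\mu(dy)$. -/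

import Mathlib

open MeasureTheory ProbabilityTheory
open scoped ENNReal

namespace SAN

universe u v

variable {p : ℕ} {𝒳 : Type u} {𝒴 : Fin p → Type v}

/-! ### Full data, materialized variables -/

/-- Values `(x, y, m)` of the full data; `m i = true` means that `y i` is missing. -/
abbrev FullData (𝒳 : Type u) (𝒴 : Fin p → Type v) : Type _ :=
  𝒳 × (∀ i, 𝒴 i) × (Fin p → Bool)

/-- Values of `(x, y^*)`: every coordinate is either a value (`Sum.inl`) or the placeholder `*`
(`Sum.inr ()`).  A value of `(x, y^*_{<j}, y_{≥j})` is a point whose coordinates `i ≥ j`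
are not `*`. -/
abbrev Materialized (𝒳 : Type u) (𝒴 : Fin p → Type v) : Type _ :=
  𝒳 × (∀ i, 𝒴 i ⊕ Unit)

/-- `(x, y, m) ↦ (x, y^*_{<k}, y_{≥k})`: the first `k` coordinates of `y` are replaced by their
materialized versions (coordinates are numbered from `0`). -/
def mask (k : ℕ) (ω : FullData 𝒳 𝒴) : Materialized 𝒳 𝒴 :=
  (ω.1, fun i => if i.val < k ∧ ω.2.2 i = true then Sum.inr () else Sum.inl (ω.2.1 i))

/-- Full materialization `(x, y, m) ↦ (x, y^*)`. -/
def materialize (ω : FullData 𝒳 𝒴) : Materialized 𝒳 𝒴 := mask p ω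

/-- `(x, y) ↦ (x, y)`, all the coordinates being observed. -/
def reveal (xy : 𝒳 × (∀ i, 𝒴 i)) : Materialized 𝒳 𝒴 :=
  (xy.1, fun i => Sum.inl (xy.2 i))

/-- Drop `y_j`: `(x, y^*_{<j}, y_{≥j}) ↦ (x, y^*_{<j}, y_{>j})`.  As the value at `j` is
overwritten by `*`, this is also the point of `(x, y^*_{≤j}, y_{>j})` with `y^*_j = *`. -/
def erase (j : Fin p) (w : Materialized 𝒳 𝒴) : Materialized 𝒳 𝒴 :=
  (w.1, Function.update w.2 j (Sum.inr ()))

/-- The event `M_j = 1`, in terms of `y^*`. -/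
def starAt (𝒳 : Type u) (𝒴 : Fin p → Type v) (j : Fin p) : Set (Materialized 𝒳 𝒴) :=
  {w | w.2 j = Sum.inr ()}

/-- The event `M_j = 1`, in terms of the full data. -/
def missing (𝒳 : Type u) (𝒴 : Fin p → Type v) (j : Fin p) : Set (FullData 𝒳 𝒴) :=
  {ω | ω.2.2 j = true}

/-- The values of `y`, with an arbitrary filling of the coordinates that are `*`; only used inside
functions that do not depend on the coordinates that are `*`. -/
noncomputable def yPart [∀ i, Nonempty (𝒴 i)] (w : Materialized 𝒳 𝒴) : ∀ i, 𝒴 i :=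
  fun i => Sum.elim id (fun _ => Classical.arbitrary (𝒴 i)) (w.2 i)

variable [MeasurableSpace 𝒳] [∀ i, MeasurableSpace (𝒴 i)]

/-- The dominating measure `ν ⊗ (⨂ μ_i) ⊗ counting measure` of the full data. -/
noncomputable def baseMeasure (ν : Measure 𝒳) (μ : ∀ i, Measure (𝒴 i)) :
    Measure (FullData 𝒳 𝒴) :=
  ν.prod ((Measure.pi μ).prod Measure.count)

/-- `f` is a full-data density `f(x, y, m)`. -/
def IsFullDataDensity (ν : Measure 𝒳) (μ : ∀ i, Measure (𝒴 i)) (f : FullData 𝒳 𝒴 → ℝ≥0∞) : Prop :=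
  Measurable f ∧ ∫⁻ ω, f ω ∂(baseMeasure ν μ) = 1

/-- The full-data distribution with density `f`. -/
noncomputable def law (ν : Measure 𝒳) (μ : ∀ i, Measure (𝒴 i)) (f : FullData 𝒳 𝒴 → ℝ≥0∞) :
    Measure (FullData 𝒳 𝒴) :=
  (baseMeasure ν μ).withDensity f

/-- The observed-data density `f(x, y_{\bar m}, m) = ∫ f(x, y, m) μ(dy_m)`, written as a function
of `(x, y, m)` that does not depend on the missing coordinates of `y`. -/
noncomputable def obsDensity (μ : ∀ i, Measure (𝒴 i)) (f : FullData 𝒳 𝒴 → ℝ≥0∞)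
    (ω : FullData 𝒳 𝒴) : ℝ≥0∞ :=
  lmarginal μ (Finset.univ.filter fun i => ω.2.2 i = true) (fun y => f (ω.1, y, ω.2.2)) ω.2.1

/-- Two full-data distributions are observationally equivalent when they give the same
distribution to the observed data `(X, Y^*)`. -/
def ObservationallyEquivalent (G H : Measure (FullData 𝒳 𝒴)) : Prop :=
  G.map materialize = H.map materialize

/-! ### Auxiliary marginal information -/

/-- `U` is a family of integrable functions of `Y` which, for each `j`, contains an almost surely
non-constant function of `y_j`. -/
def IsAuxiliaryFamily (U : Set ((∀ i, 𝒴 i) → ℝ)) (H : Measure (FullData 𝒳 𝒴)) : Prop :=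
  (∀ u ∈ U, Measurable u ∧ Integrable (fun ω => u ω.2.1) H) ∧
    ∀ j, ∃ u ∈ U, DependsOn u {j} ∧ ¬ ∃ c : ℝ, ∀ᵐ ω ∂H, u ω.2.1 = c

/-- The functions of `U` that depend exclusively on `y_{≥j}`. -/
def auxFrom (U : Set ((∀ i, 𝒴 i) → ℝ)) (j : Fin p) : Set ((∀ i, 𝒴 i) → ℝ) :=
  {u ∈ U | DependsOn u {i | j ≤ i}}

/-! ### Links and `f`-projections -/

/-- A regular link function `(0, 1) → ℝ`: differentiable and monotonically increasing. -/
def RegularLink (lam : ℝ → ℝ) : Prop :=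
  DifferentiableOn ℝ lam (Set.Ioo 0 1) ∧ MonotoneOn lam (Set.Ioo 0 1)

/-- The growth condition on the function of an `f`-divergence. -/
def GrowthCondition (f : ℝ → ℝ) : Prop :=
  ∀ t > 1, ∃ t₀ > 0, ∃ t₁ > 0, ∃ t₂ > 0, ∃ t₃ > 0, ∀ z > t₀,
    f (t * z) ≤ t₁ * f z + t₂ * z + t₃

/-- `c = (1 - π) / π`. -/
noncomputable def odds (π : ℝ) : ℝ := (1 - π) / π

/-- The function `z ↦ ∫_0^z λ[v / (c + v)] dv`. -/
noncomputable def linkDiv (lam : ℝ → ℝ) (c z : ℝ) : ℝ :=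
  ∫ v in (0 : ℝ)..z, lam (v / (c + v))

open Classical in
/-- The `f`-divergence `∫ f(dP/dQ) dQ` of `P ≪ Q`, for a convex `f`; it is `+∞` when the
integral diverges (the negative part of `f(dP/dQ)` is always integrable) or when `P` is not
dominated by `Q`. -/
noncomputable def fDivergence {Ω : Type*} [MeasurableSpace Ω] (f : ℝ → ℝ) (P Q : Measure Ω) :
    EReal :=
  if P ≪ Q ∧ Integrable (fun w => f (P.rnDeriv Q w).toReal) Q then
    ((∫ w, f (P.rnDeriv Q w).toReal ∂Q : ℝ) : EReal)
  else ⊤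

/-- `P` is an `f`-projection of `Q` onto the set `C` of distributions: an element of `C` with
finite and minimal divergence. -/
def IsFProjection {Ω : Type*} [MeasurableSpace Ω] (f : ℝ → ℝ) (Q : Measure Ω)
    (C : Set (Measure Ω)) (P : Measure Ω) : Prop :=
  P ∈ C ∧ fDivergence f P Q ≠ ⊤ ∧ ∀ P' ∈ C, fDivergence f P Q ≤ fDivergence f P' Q

/-! ### The construction of a full-data distribution -/

/-- `E_g[u(Y_{≥j}) | M_j = 1] = {E[u(Y)] - ∫ u(y_{≥j}) g(y_{≥j}, M_j = 0)} / π_j`, where `D` is the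
law `g(x, y^*_{≤j}, y_{>j})` and `e u` is the input value `E[u(Y)]`. -/
noncomputable def auxMissing [∀ i, Nonempty (𝒴 i)] (e : ((∀ i, 𝒴 i) → ℝ) → ℝ) (j : Fin p)
    (D : Measure (Materialized 𝒳 𝒴)) (u : (∀ i, 𝒴 i) → ℝ) : ℝ :=
  (e u - ∫ w in (starAt 𝒳 𝒴 j)ᶜ, u (yPart w) ∂D) / D.real (starAt 𝒳 𝒴 j)

/-- The distributions of `(x, y^*_{<j}, y_{≥j})` that match the marginal
`g(x, y^*_{<j}, y_{>j} | M_j = 1)` and the expectations `E_g[u(Y_{≥j}) | M_j = 1]`,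
`u ∈ U_{≥j}`. -/
def matching [∀ i, Nonempty (𝒴 i)] (U : Set ((∀ i, 𝒴 i) → ℝ)) (e : ((∀ i, 𝒴 i) → ℝ) → ℝ)
    (j : Fin p) (D : Measure (Materialized 𝒳 𝒴)) : Set (Measure (Materialized 𝒳 𝒴)) :=
  {P | IsProbabilityMeasure P ∧ P (starAt 𝒳 𝒴 j) = 0 ∧
    P.map (erase j) = ProbabilityTheory.cond D (starAt 𝒳 𝒴 j) ∧
    ∀ u ∈ auxFrom U j, Integrable (fun w => u (yPart w)) P ∧
      ∫ w, u (yPart w) ∂P = auxMissing e j D u}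

/-- A run of the construction, for the link `lam`, from the law `obs` of `(X, Y^*)` and the
expectations `e u`, `u ∈ U`.  With coordinates numbered from `0`, the step for the coordinate `j`
goes from `D j.succ`, the law `g(x, y^*_{≤j}, y_{>j})`, to `D j.castSucc`, the law
`g(x, y^*_{<j}, y_{≥j})`; and `P j` is the law `g(x, y^*_{<j}, y_{≥j} | M_j = 1)`. -/
structure IsRun [∀ i, Nonempty (𝒴 i)] (lam : ℝ → ℝ) (U : Set ((∀ i, 𝒴 i) → ℝ))
    (obs : Measure (Materialized 𝒳 𝒴)) (e : ((∀ i, 𝒴 i) → ℝ) → ℝ)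
    (D : Fin (p + 1) → Measure (Materialized 𝒳 𝒴)) (P : Fin p → Measure (Materialized 𝒳 𝒴)) :
    Prop where
  /-- The input. -/
  input : D (Fin.last p) = obs
  /-- The integrals in the definition of the expectations given `M_j = 1` make sense. -/
  integrable : ∀ j, ∀ u ∈ auxFrom U j,
    IntegrableOn (fun w => u (yPart w)) (starAt 𝒳 𝒴 j)ᶜ (D j.succ)
  /-- The projection step. -/
  projection : ∀ j, IsFProjection (linkDiv lam (odds ((D j.succ).real (starAt 𝒳 𝒴 j))))
    (ProbabilityTheory.cond (D j.succ) (starAt 𝒳 𝒴 j)ᶜ) (matching U e j (D j.succ)) (P j)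
  /-- The mixture of the two laws given `M_j = 1` and given `M_j = 0`. -/
  mixture : ∀ j, D j.castSucc = D j.succ (starAt 𝒳 𝒴 j) • P j +
    (1 - D j.succ (starAt 𝒳 𝒴 j)) • ProbabilityTheory.cond (D j.succ) (starAt 𝒳 𝒴 j)ᶜ

/-- The conditional density
`g(m_j | x, y^*_{<j}, y_{≥j})
  = π_j^{m_j} (1 - π_j)^{1 - m_j} g(x, y^*_{<j}, y_{≥j} | M_j = m_j) / g(x, y^*_{<j}, y_{≥j})`
found in the step for the coordinate `j`. -/
noncomputable def stepKernel (D : Fin (p + 1) → Measure (Materialized 𝒳 𝒴))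
    (P : Fin p → Measure (Materialized 𝒳 𝒴)) (j : Fin p) (b : Bool) (w : Materialized 𝒳 𝒴) : ℝ≥0∞ :=
  if b then (D j.succ (starAt 𝒳 𝒴 j) • P j).rnDeriv (D j.castSucc) w
  else ((1 - D j.succ (starAt 𝒳 𝒴 j)) •
    ProbabilityTheory.cond (D j.succ) (starAt 𝒳 𝒴 j)ᶜ).rnDeriv (D j.castSucc) w

/-- `g(x, y, m) = g(x, y) ∏_j g(m_j | x, y^*_{<j}, y_{≥j})` is an output of the construction; here
`q` is the density `g(x, y)` of the last law `D 0`. -/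
def IsOutput [∀ i, Nonempty (𝒴 i)] (ν : Measure 𝒳) (μ : ∀ i, Measure (𝒴 i)) (lam : ℝ → ℝ)
    (U : Set ((∀ i, 𝒴 i) → ℝ)) (obs : Measure (Materialized 𝒳 𝒴)) (e : ((∀ i, 𝒴 i) → ℝ) → ℝ)
    (g : FullData 𝒳 𝒴 → ℝ≥0∞) : Prop :=
  ∃ (D : Fin (p + 1) → Measure (Materialized 𝒳 𝒴)) (P : Fin p → Measure (Materialized 𝒳 𝒴))
    (q : 𝒳 × (∀ i, 𝒴 i) → ℝ≥0∞),
    IsRun lam U obs e D P ∧ Measurable q ∧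
    ((ν.prod (Measure.pi μ)).withDensity q).map reveal = D 0 ∧
    Measurable g ∧
    ∀ᵐ ω ∂(baseMeasure ν μ),
      g ω = q (ω.1, ω.2.1) * ∏ j, stepKernel D P j (ω.2.2 j) (mask j ω)

/-! ### Sequential additive nonignorability -/

/-- The indicator of `M_j = 1`. -/
noncomputable def missInd (𝒳 : Type u) (𝒴 : Fin p → Type v) (j : Fin p) : FullData 𝒳 𝒴 → ℝ :=
  (missing 𝒳 𝒴 j).indicator fun _ => 1

/-- `G(M_j = 1 | x, y^*_{<j}, y_{≥j})`, as a random variable. -/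
noncomputable def missProb (G : Measure (FullData 𝒳 𝒴)) (j : Fin p) : FullData 𝒳 𝒴 → ℝ :=
  condExp (MeasurableSpace.comap (mask (j : ℕ)) inferInstance) G (missInd 𝒳 𝒴 j)

/-- `G(M_j = 1 | x, y, m_{<j})`, as a random variable. -/
noncomputable def missProbHistory (G : Measure (FullData 𝒳 𝒴)) (j : Fin p) : FullData 𝒳 𝒴 → ℝ :=
  condExp (MeasurableSpace.comap
    (fun ω : FullData 𝒳 𝒴 => (ω.1, ω.2.1, fun i : {i : Fin p // i < j} => ω.2.2 i))
    inferInstance) G (missInd 𝒳 𝒴 j)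

/-- The missingness mechanism of the full-data distribution `G` is sequentially additive
nonignorable for the link `lam` (the factorization `f(m | x, y) = ∏_j f(m_j | x, y, m_{<j})` being
the chain rule).  As `lam` is a function on `(0, 1)`, the conditional probability has to be `< 1`,
and its link is read where the conditional probability is not `0`, that is, almost surely given
`M_j = 1`. -/
def SequentiallyAdditive (lam : ℝ → ℝ) (G : Measure (FullData 𝒳 𝒴)) : Prop :=
  ∀ j, missProbHistory G j =ᵐ[G] missProb G j ∧
    ∃ (α : Materialized 𝒳 𝒴 → ℝ) (β : (∀ i, 𝒴 i) → ℝ), DependsOn β {i | j ≤ i} ∧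
      ∀ᵐ ω ∂G, missProb G j ω < 1 ∧
        (0 < missProb G j ω →
          lam (missProb G j ω) = α (erase j (mask j ω)) + β ω.2.1)

/-- The linear span of `L_1{G(x, y^*_{<j}, y_{>j} | M_j = 1)} ∪ U_{≥j}`, the elements being seen as
functions on the full data. -/
noncomputable def linkSpan (U : Set ((∀ i, 𝒴 i) → ℝ)) (G : Measure (FullData 𝒳 𝒴)) (j : Fin p) :
    Submodule ℝ (FullData 𝒳 𝒴 → ℝ) :=
  Submodule.span ℝ
    ({φ | ∃ α : Materialized 𝒳 𝒴 → ℝ,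
        Integrable α ((ProbabilityTheory.cond G (missing 𝒳 𝒴 j)).map
          fun ω => erase j (mask j ω)) ∧
        φ = fun ω => α (erase j (mask j ω))} ∪
      {φ | ∃ u ∈ auxFrom U j, φ = fun ω => u ω.2.1})

/-- `φ` is in the closure of `V` in `L_1(P)`. -/
def InL1Closure {Ω : Type*} [MeasurableSpace Ω] (P : Measure Ω) (V : Submodule ℝ (Ω → ℝ))
    (φ : Ω → ℝ) : Prop :=
  Integrable φ P ∧ ∀ ε : ℝ, 0 < ε → ∃ v ∈ V, Integrable v P ∧ ∫ ω, |φ ω - v ω| ∂P < ε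

end SAN

/-! The output describes a sampling scheme: (X, Y) has the last law `D 0`, and then the indicators
are drawn in increasing order, M_j from a kernel that sees only (x, y^*_{<j}, y_{≥j}). Step j of the
construction inverts the j-th draw. Because `P j` matches the marginal given M_j = 1, drawing M_j
and erasing y_j when M_j = 1 turns `D j.castSucc` back into `D j.succ`. By induction the masked law
at every level k is `D k` (`IsRun.map_mask_partialLaw`, `IsRun.map_mask_output`). At the top level
this is observational equivalence. At level 0 it gives the auxiliary expectations, since every u in
U depends only on the coordinates from the first one on and was therefore matched in the step for
that coordinate.

The additive form of the mechanism is the first-order condition of the projection. Let r be the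
density of `P j` with respect to the law Q given M_j = 0. Bayes' rule turns the kernel into r / (c_j
+ r), so that the derivative of f_{λ,j} at r is λ of the kernel (`IsRun.toReal_stepKernel_true`). If
k is bounded by 1 and orthogonal to the constraints, then (1 + tk) `P j` still satisfies them for 0
< t ≤ 1/2. Minimality and convexity give ∫ k λ(kernel) d`P j` ≥ 0, hence equality on replacing k by
-k; the growth condition supplies the dominating function for the limit t → 0. By Hahn-Banach and
the duality of L¹ with bounded functions, λ(kernel) lies in the L¹-closure of the span of the
constraints (`IsFProjection.inL1Closure_link`).

Along a subsequence, λ(kernel) is then an almost sure limit of sums α_n + β_n. The two sequences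
need not converge separately, but a linear extension of the limit functional to all real sequences
splits the limit into one term of each kind (`exists_add_of_tendsto`). -/

namespace SAN

/-! ### Duality for `L¹` and limits of additive functions -/

/-- A continuous linear functional on `L¹` of a probability measure is the integral against a
bounded function. -/
theorem exists_bounded_repr {Ω : Type*} [MeasurableSpace Ω] (P : Measure Ω)
    [IsProbabilityMeasure P] (l : Lp ℝ 1 P →L[ℝ] ℝ) :
    ∃ k : Ω → ℝ, Measurable k ∧ (∀ w, |k w| ≤ ‖l‖) ∧
      ∀ f : Lp ℝ 1 P, l f = ∫ w, k w * f w ∂P := by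
  have hle : ∀ f : Lp ℝ 2 P, eLpNorm f 1 P ≤ eLpNorm f 2 P := fun f =>
    eLpNorm_le_eLpNorm_of_exponent_le (by norm_num) (Lp.aestronglyMeasurable f)
  have hmem : ∀ f : Lp ℝ 2 P, MemLp f 1 P := fun f => (Lp.memLp f).mono_exponent (by norm_num)
  -- The inclusion of L² in L¹ is a contraction for a probability measure. Composed with it, `l`
  -- becomes a functional on a Hilbert space, represented by some `k2`.
  let T : Lp ℝ 2 P →ₗ[ℝ] Lp ℝ 1 P :=
    { toFun := fun f => (hmem f).toLp f
      map_add' := fun f g => by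
        rw [← MemLp.toLp_add]
        exact MemLp.toLp_congr _ _ (Lp.coeFn_add f g)
      map_smul' := fun c f => by
        rw [RingHom.id_apply, ← MemLp.toLp_const_smul]
        exact MemLp.toLp_congr _ _ (Lp.coeFn_smul c f) }
  let Tc : Lp ℝ 2 P →L[ℝ] Lp ℝ 1 P := T.mkContinuous 1 fun f => by
    rw [one_mul]
    change ‖(hmem f).toLp f‖ ≤ ‖f‖
    rw [Lp.norm_toLp, Lp.norm_def]
    exact ENNReal.toReal_mono (Lp.eLpNorm_ne_top f) (hle f)
  let k2 : Lp ℝ 2 P := (InnerProductSpace.toDual ℝ (Lp ℝ 2 P)).symm (l.comp Tc)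
  have hk2 : ∀ f : Lp ℝ 2 P, l (Tc f) = ∫ w, f w * k2 w ∂P := fun f => by
    have h1 : inner ℝ k2 f = l (Tc f) := InnerProductSpace.toDual_symm_apply
    rw [← h1, L2.inner_def]
    simp
  have hk2i : Integrable k2 P := (hmem k2).integrable le_rfl
  have hind : ∀ (s : Set Ω) (hs : MeasurableSet s),
      l (indicatorConstLp 1 hs (measure_ne_top P s) (1 : ℝ)) = ∫ w in s, k2 w ∂P := by
    intro s hs
    have h1 : Tc (indicatorConstLp 2 hs (measure_ne_top P s) (1 : ℝ)) =
        indicatorConstLp 1 hs (measure_ne_top P s) (1 : ℝ) := by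
      change (hmem _).toLp _ = _
      refine MemLp.toLp_congr _ _ ?_
      exact indicatorConstLp_coeFn
    rw [← h1, hk2, ← integral_indicator hs]
    refine integral_congr_ae ?_
    filter_upwards [indicatorConstLp_coeFn (p := 2) (hs := hs) (hμs := measure_ne_top P s)
      (c := (1 : ℝ))] with w hw
    rw [hw]
    by_cases hws : w ∈ s <;> simp [hws]
  have hbd : ∀ (s : Set Ω), MeasurableSet s → |∫ w in s, k2 w ∂P| ≤ ‖l‖ * P.real s := by
    intro s hs
    rw [← hind s hs, ← Real.norm_eq_abs]
    refine (l.le_opNorm _).trans_eq ?_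
    rw [norm_indicatorConstLp (by norm_num) (by norm_num)]
    simp
  have hconst : ∀ (c : ℝ) (s : Set Ω), ∫ _w in s, c ∂P = c * P.real s := fun c s => by
    rw [setIntegral_const, smul_eq_mul, mul_comm]
  -- Since |∫_s k2| ≤ ‖l‖ P(s) for every s, the bound holds almost everywhere. Clipping a measurable
  -- version of `k2` makes it hold everywhere.
  have hup : ∀ᵐ w ∂P, k2 w ≤ ‖l‖ := by
    refine ae_le_of_forall_setIntegral_le hk2i (integrable_const _) fun s hs _ => ?_
    rw [hconst]
    exact (le_abs_self _).trans (hbd s hs)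
  have hlow : ∀ᵐ w ∂P, -‖l‖ ≤ k2 w := by
    refine ae_le_of_forall_setIntegral_le (integrable_const _) hk2i fun s hs _ => ?_
    rw [hconst, neg_mul]
    exact neg_le_of_abs_le (hbd s hs)
  obtain ⟨k0, hk0m, hk0⟩ := (Lp.aestronglyMeasurable k2).aemeasurable
  let k : Ω → ℝ := fun w => max (-‖l‖) (min ‖l‖ (k0 w))
  have hkm : Measurable k := measurable_const.max (measurable_const.min hk0m)
  have hkb : ∀ w, |k w| ≤ ‖l‖ := fun w => abs_le.2
    ⟨le_max_left _ _, max_le (neg_le_self (norm_nonneg l)) (min_le_left _ _)⟩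
  have hkk : k2 =ᵐ[P] k := by
    filter_upwards [hk0, hup, hlow] with w h1 h2 h3
    rw [h1] at h2 h3 ⊢
    simp only [k]
    rw [min_eq_right h2, max_eq_right h3]
  refine ⟨k, hkm, hkb, ?_⟩
  let L : Lp ℝ 1 P →ₗ[ℝ] ℝ :=
    { toFun := fun f => ∫ w, k w * f w ∂P
      map_add' := fun f g => by
        have hi : ∀ f : Lp ℝ 1 P, Integrable (fun w => k w * f w) P := fun f =>
          ((Lp.memLp f).integrable le_rfl).bdd_mul hkm.aestronglyMeasurable
            (ae_of_all _ fun w => hkb w)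
        rw [← integral_add (hi f) (hi g)]
        refine integral_congr_ae ?_
        filter_upwards [Lp.coeFn_add f g] with w hw
        rw [hw, Pi.add_apply, mul_add]
      map_smul' := fun c f => by
        rw [RingHom.id_apply, smul_eq_mul, ← integral_const_mul]
        refine integral_congr_ae ?_
        filter_upwards [Lp.coeFn_smul c f] with w hw
        rw [hw, Pi.smul_apply, smul_eq_mul]
        ring }
  let Lc : Lp ℝ 1 P →L[ℝ] ℝ := L.mkContinuous ‖l‖ fun f => by
    have hf : Integrable f P := (Lp.memLp f).integrable le_rfl
    change ‖∫ w, k w * f w ∂P‖ ≤ _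
    rw [L1.norm_eq_integral_norm, ← integral_const_mul]
    refine norm_integral_le_of_norm_le (hf.norm.const_mul _) (ae_of_all _ fun w => ?_)
    rw [norm_mul]
    exact mul_le_mul_of_nonneg_right (hkb w) (norm_nonneg _)
  intro f
  change l f = Lc f
  induction f using Lp.induction (p := 1) (by norm_num) with
  | indicatorConst c hs hμs =>
    rename_i s
    have h1 : indicatorConstLp 1 hs hμs.ne c = c • indicatorConstLp 1 hs hμs.ne (1 : ℝ) := by
      refine Lp.ext ((indicatorConstLp_coeFn).trans ?_)
      filter_upwards [Lp.coeFn_smul c (indicatorConstLp 1 hs hμs.ne (1 : ℝ)),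
        indicatorConstLp_coeFn (p := 1) (hs := hs) (hμs := hμs.ne) (c := (1 : ℝ))] with w h2 h3
      rw [h2, Pi.smul_apply, h3]
      by_cases hws : w ∈ s <;> simp [hws]
    have h2 : ((Lp.simpleFunc.indicatorConst 1 hs hμs.ne c : Lp.simpleFunc ℝ 1 P) : Lp ℝ 1 P)
        = c • indicatorConstLp 1 hs hμs.ne (1 : ℝ) := by
      rw [← h1]; rfl
    rw [h2, map_smul, map_smul, hind s hs]
    congr 1
    change _ = ∫ w, k w * indicatorConstLp 1 hs hμs.ne (1 : ℝ) w ∂P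
    rw [← integral_indicator hs]
    refine integral_congr_ae ?_
    filter_upwards [hkk, indicatorConstLp_coeFn (p := 1) (hs := hs) (hμs := hμs.ne)
      (c := (1 : ℝ))] with w h3 hw
    rw [hw]
    by_cases hws : w ∈ s <;> simp [hws, h3]
  | add _ _ _ h1 h2 => rw [map_add, map_add, h1, h2]
  | isClosed => exact isClosed_eq l.continuous Lc.continuous

/-- By the Hahn-Banach theorem, a function is in the `L¹`-closure of a subspace as soon as it is
orthogonal to the bounded functions that are orthogonal to the subspace. -/
theorem inL1Closure_of_forall_bounded {Ω : Type*} [MeasurableSpace Ω] (P : Measure Ω)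
    [IsProbabilityMeasure P] (V : Submodule ℝ (Ω → ℝ)) (hV : ∀ v ∈ V, Integrable v P)
    (φ : Ω → ℝ) (hφ : Integrable φ P)
    (horth : ∀ k : Ω → ℝ, Measurable k → (∀ w, |k w| ≤ 1) →
      (∀ v ∈ V, ∫ w, k w * v w ∂P = 0) → ∫ w, k w * φ w ∂P = 0) :
    InL1Closure P V φ := by
  refine ⟨hφ, ?_⟩
  let W : Submodule ℝ (Lp ℝ 1 P) :=
    { carrier := {f | ∃ v ∈ V, f =ᵐ[P] v}
      add_mem' := by
        rintro f g ⟨v, hv, hfv⟩ ⟨v', hv', hgv⟩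
        exact ⟨v + v', V.add_mem hv hv', (Lp.coeFn_add f g).trans (hfv.add hgv)⟩
      zero_mem' := ⟨0, V.zero_mem, Lp.coeFn_zero _ _ _⟩
      smul_mem' := by
        rintro c f ⟨v, hv, hfv⟩
        exact ⟨c • v, V.smul_mem c hv, (Lp.coeFn_smul c f).trans (hfv.const_smul c)⟩ }
  have hmem : (memLp_one_iff_integrable.2 hφ).toLp φ ∈ closure (W : Set (Lp ℝ 1 P)) := by
    by_contra hnot
    obtain ⟨l, s, hl, hs⟩ := geometric_hahn_banach_closed_point
      (W.convex.closure) isClosed_closure hnot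
    -- A functional bounded above on a subspace vanishes there: otherwise some multiple of f would
    -- take the value s + 1.
    have hl0 : ∀ f ∈ W, l f = 0 := by
      intro f hf
      by_contra hne
      have h1 := hl (((s + 1) / l f) • f) (subset_closure (W.smul_mem _ hf))
      rw [map_smul, smul_eq_mul, div_mul_cancel₀ _ hne] at h1
      linarith
    have hs0 : 0 < s := by simpa using hl 0 (subset_closure W.zero_mem)
    obtain ⟨k, hkm, hkb, hk⟩ := exists_bounded_repr P l
    -- Dividing by ‖l‖ + 1 rather than ‖l‖ normalizes `k` without a case distinction on `l`.
    have hM : 0 < ‖l‖ + 1 := by positivity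
    have h1 := horth (fun w => (‖l‖ + 1)⁻¹ * k w) (hkm.const_mul _) (fun w => by
      rw [abs_mul, abs_of_pos (inv_pos.2 hM), inv_mul_le_iff₀ hM]
      linarith [hkb w]) (fun v hv => by
        have h2 := hl0 ((memLp_one_iff_integrable.2 (hV v hv)).toLp v) ⟨v, hv, MemLp.coeFn_toLp _⟩
        rw [hk] at h2
        have h3 : ∫ w, k w * v w ∂P = 0 := by
          rw [← h2]
          refine integral_congr_ae ?_
          filter_upwards [MemLp.coeFn_toLp (memLp_one_iff_integrable.2 (hV v hv))] with w hw
          rw [hw]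
        simp_rw [mul_assoc]
        rw [integral_const_mul, h3, mul_zero])
    simp_rw [mul_assoc] at h1
    rw [integral_const_mul] at h1
    have h4 : ∫ w, k w * φ w ∂P = 0 := (mul_eq_zero.1 h1).resolve_left (inv_pos.2 hM).ne'
    rw [hk] at hs
    have h5 : ∫ w, k w * (memLp_one_iff_integrable.2 hφ).toLp φ w ∂P = ∫ w, k w * φ w ∂P := by
      refine integral_congr_ae ?_
      filter_upwards [MemLp.coeFn_toLp (memLp_one_iff_integrable.2 hφ)] with w hw
      rw [hw]
    linarith
  intro ε hε
  obtain ⟨f, ⟨v, hv, hfv⟩, hd⟩ := Metric.mem_closure_iff.1 hmem ε hε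
  refine ⟨v, hv, hV v hv, ?_⟩
  rw [dist_eq_norm, L1.norm_eq_integral_norm] at hd
  refine lt_of_eq_of_lt (integral_congr_ae ?_) hd
  filter_upwards [hfv, Lp.coeFn_sub ((memLp_one_iff_integrable.2 hφ).toLp φ) f,
    MemLp.coeFn_toLp (memLp_one_iff_integrable.2 hφ)] with w h1 h2 h3
  rw [h2, Pi.sub_apply, h1, h3, Real.norm_eq_abs]

/-- A pointwise limit of sums `α_n(a) + β_n(b)` is such a sum. -/
theorem exists_add_of_tendsto {ι A B : Type*} (W : Set ι) (a : ι → A) (b : ι → B)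
    (α : ℕ → A → ℝ) (β : ℕ → B → ℝ) (φ : ι → ℝ)
    (h : ∀ w ∈ W, Filter.Tendsto (fun n => α n (a w) + β n (b w)) Filter.atTop (nhds (φ w))) :
    ∃ L : (ℕ → ℝ) →ₗ[ℝ] ℝ, ∀ w ∈ W, φ w = L (fun n => α n (a w)) + L (fun n => β n (b w)) := by
  let S : Submodule ℝ (ℕ → ℝ) :=
    { carrier := {s | ∃ x, Filter.Tendsto s Filter.atTop (nhds x)}
      add_mem' := by
        rintro s t ⟨x, hx⟩ ⟨y, hy⟩
        exact ⟨x + y, hx.add hy⟩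
      zero_mem' := ⟨0, tendsto_const_nhds⟩
      smul_mem' := by
        rintro c s ⟨x, hx⟩
        exact ⟨c • x, hx.const_smul c⟩ }
  let l : S →ₗ[ℝ] ℝ :=
    { toFun := fun s => s.2.choose
      map_add' := fun s t => tendsto_nhds_unique (s + t).2.choose_spec
        (s.2.choose_spec.add t.2.choose_spec)
      map_smul' := fun c s => tendsto_nhds_unique (c • s).2.choose_spec
        (s.2.choose_spec.const_smul c) }
  -- The limit functional on convergent sequences is extended to all sequences by pure linear
  -- algebra; no continuity or positivity is needed, since only additivity is applied to the two
  -- summands.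
  obtain ⟨L, hL⟩ := l.exists_extend
  refine ⟨L, fun w hw => ?_⟩
  have h1 : L (fun n => α n (a w) + β n (b w)) = l ⟨_, φ w, h w hw⟩ := by
    rw [← hL]; rfl
  have h2 : l ⟨_, φ w, h w hw⟩ = φ w :=
    tendsto_nhds_unique (Subtype.prop (⟨_, φ w, h w hw⟩ : S)).choose_spec (h w hw)
  rw [← map_add, ← h2, ← h1]
  rfl

/-! ### Convexity and growth of the link divergence -/

theorem div_add_mem_Ioo {c v : ℝ} (hc : 0 < c) (hv : 0 < v) : v / (c + v) ∈ Set.Ioo (0 : ℝ) 1 :=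
  ⟨by positivity, by rw [div_lt_one (by positivity)]; linarith⟩

theorem link_le_link {lam : ℝ → ℝ} (hlam : RegularLink lam) {c : ℝ} (hc : 0 < c) {v w : ℝ}
    (hv : 0 < v) (hvw : v ≤ w) : lam (v / (c + v)) ≤ lam (w / (c + w)) := by
  have hw : 0 < w := hv.trans_le hvw
  refine hlam.2 (div_add_mem_Ioo hc hv) (div_add_mem_Ioo hc hw) ?_
  rw [div_le_div_iff₀ (by positivity) (by positivity)]
  nlinarith

theorem continuousOn_link {lam : ℝ → ℝ} (hlam : RegularLink lam) {c : ℝ} (hc : 0 < c) :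
    ContinuousOn (fun v => lam (v / (c + v))) (Set.Ioi 0) := by
  refine hlam.1.continuousOn.comp ?_ fun v hv => div_add_mem_Ioo hc hv
  refine continuousOn_id.div (continuousOn_const.add continuousOn_id) fun v hv => ?_
  have : 0 < v := hv
  exact (add_pos hc this).ne'

theorem intervalIntegrable_link {lam : ℝ → ℝ} {c : ℝ}
    (hint : ∀ z > 0, IntervalIntegrable (fun v => lam (v / (c + v))) volume 0 z) {a b : ℝ}
    (ha : 0 ≤ a) (hb : 0 ≤ b) :
    IntervalIntegrable (fun v => lam (v / (c + v))) volume a b := by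
  have h0 : ∀ z, 0 ≤ z → IntervalIntegrable (fun v => lam (v / (c + v))) volume 0 z := by
    intro z hz
    rcases hz.eq_or_lt with rfl | hz
    · exact IntervalIntegrable.refl
    · exact hint z hz
  exact (h0 a ha).symm.trans (h0 b hb)

theorem linkDiv_sub {lam : ℝ → ℝ} {c : ℝ}
    (hint : ∀ z > 0, IntervalIntegrable (fun v => lam (v / (c + v))) volume 0 z) {a b : ℝ}
    (ha : 0 ≤ a) (hb : 0 ≤ b) :
    linkDiv lam c b - linkDiv lam c a = ∫ v in a..b, lam (v / (c + v)) :=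
  intervalIntegral.integral_interval_sub_left (intervalIntegrable_link hint le_rfl hb)
    (intervalIntegrable_link hint le_rfl ha)

theorem linkDiv_zero (lam : ℝ → ℝ) (c : ℝ) : linkDiv lam c 0 = 0 :=
  intervalIntegral.integral_same

/-- The graph of `linkDiv` is above its tangents. -/
theorem linkDiv_tangent {lam : ℝ → ℝ} (hlam : RegularLink lam) {c : ℝ} (hc : 0 < c)
    (hint : ∀ z > 0, IntervalIntegrable (fun v => lam (v / (c + v))) volume 0 z) {a b : ℝ}
    (ha : 0 < a) (hb : 0 ≤ b) :
    linkDiv lam c a + lam (a / (c + a)) * (b - a) ≤ linkDiv lam c b := by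
  rcases le_total a b with hab | hab
  · have h1 := linkDiv_sub hint ha.le hb
    have h2 : ∫ _v in a..b, lam (a / (c + a)) ≤ ∫ v in a..b, lam (v / (c + v)) :=
      intervalIntegral.integral_mono_on hab intervalIntegrable_const
        (intervalIntegrable_link hint ha.le hb) fun v hv => link_le_link hlam hc ha hv.1
    rw [intervalIntegral.integral_const, smul_eq_mul] at h2
    linarith
  · have h1 := linkDiv_sub hint hb ha.le
    -- When b = 0 the integrand at the left end is `lam 0`, outside the domain of monotonicity;
    -- hence the comparison on the open interval.
    have h2 : ∫ v in b..a, lam (v / (c + v)) ≤ ∫ _v in b..a, lam (a / (c + a)) :=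
      intervalIntegral.integral_mono_on_of_le_Ioo hab (intervalIntegrable_link hint hb ha.le)
        intervalIntegrable_const fun v hv => link_le_link hlam hc (hb.trans_lt hv.1) hv.2.le
    rw [intervalIntegral.integral_const, smul_eq_mul] at h2
    linarith

/-- The endpoint 0 is included because the density ratio may vanish. -/
theorem continuousOn_linkDiv {lam : ℝ → ℝ} {c : ℝ}
    (hint : ∀ z > 0, IntervalIntegrable (fun v => lam (v / (c + v))) volume 0 z) :
    ContinuousOn (linkDiv lam c) (Set.Ici 0) := by
  intro x hx
  have hx0 : (0 : ℝ) ≤ x := hx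
  have h1 : ContinuousOn (linkDiv lam c) (Set.uIcc 0 (x + 1)) :=
    intervalIntegral.continuousOn_primitive_interval' (hint (x + 1) (by linarith))
      Set.left_mem_uIcc
  rw [Set.uIcc_of_le (by linarith)] at h1
  refine (h1 x ⟨hx0, by linarith⟩).mono_of_mem_nhdsWithin ?_
  rw [← Set.Ici_inter_Iic]
  exact Filter.inter_mem self_mem_nhdsWithin
    (mem_nhdsWithin_of_mem_nhds (Iic_mem_nhds (by linarith)))

/-- Bounds for the dilations of `linkDiv` and of its derivative. -/
theorem exists_linkDiv_bound {lam : ℝ → ℝ} (hlam : RegularLink lam) {c : ℝ} (hc : 0 < c)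
    (hint : ∀ z > 0, IntervalIntegrable (fun v => lam (v / (c + v))) volume 0 z)
    (hgrowth : GrowthCondition (linkDiv lam c)) :
    ∃ K : ℝ, (∀ z, 0 ≤ z → ∀ s, 0 ≤ s → s ≤ 2 →
        |linkDiv lam c (s * z)| ≤ K * (|linkDiv lam c z| + z + 1)) ∧
      ∀ z, 0 < z → ∀ s, 1 / 2 ≤ s → s ≤ 3 / 2 →
        |z * lam (s * z / (c + s * z))| ≤ K * (|linkDiv lam c z| + z + 1) := by
  set f := linkDiv lam c with hf
  -- Growth is needed only for the dilation factor 2. For z ≤ t₀ the point 2z lies in a compact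
  -- interval, where continuity gives the bound M.
  obtain ⟨t₀, ht₀, t₁, ht₁, t₂, ht₂, t₃, ht₃, hg⟩ := hgrowth 2 (by norm_num)
  obtain ⟨M, hM⟩ := (isCompact_Icc (a := (0 : ℝ)) (b := 2 * t₀)).exists_bound_of_continuousOn
    ((continuousOn_linkDiv hint).mono fun x hx => hx.1)
  have hM0 : 0 ≤ M := (norm_nonneg _).trans (hM 0 ⟨le_rfl, by linarith⟩)
  set l := lam (1 / (c + 1)) with hl
  -- The tangent at 1 is an affine lower bound.
  have hlow : ∀ z, 0 ≤ z → -(|f 1| + |l| * (z + 1)) ≤ f z := fun z hz => by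
    have h1 := linkDiv_tangent hlam hc hint one_pos hz
    have h2 : -(|l| * (z + 1)) ≤ l * (z - 1) := by
      rw [← abs_of_nonneg (show (0 : ℝ) ≤ z + 1 by linarith), ← abs_mul]
      rcases abs_cases l with h | h <;> rcases abs_cases (l * (z + 1)) with h' | h' <;> nlinarith
    have h3 := neg_abs_le (f 1)
    change f 1 + l * (z - 1) ≤ f z at h1
    linarith
  have hup : ∀ z, 0 ≤ z → f (2 * z) ≤ t₁ * |f z| + t₂ * z + (t₃ + M) := fun z hz => by
    by_cases hzt : t₀ < z
    · have h1 := hg z hzt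
      have h2 := mul_le_mul_of_nonneg_left (le_abs_self (f z)) ht₁.le
      linarith
    · have h1 := (le_abs_self _).trans (hM (2 * z) ⟨by linarith, by linarith⟩)
      have h2 : 0 ≤ t₁ * |f z| := by positivity
      have h3 : 0 ≤ t₂ * z := by positivity
      change f (2 * z) ≤ M at h1
      linarith
  -- As f is convex with f(0) = 0, one has f(sz) ≤ (s/2) f(2z); the proof combines the tangents at
  -- sz, read at 0 and at 2z.
  have hmid : ∀ z, 0 ≤ z → ∀ s, 0 ≤ s → s ≤ 2 → f (s * z) ≤ |f (2 * z)| := by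
    intro z hz s hs hs2
    rcases (mul_nonneg hs hz).eq_or_lt with h0 | h0
    · rw [← h0, hf, linkDiv_zero]; exact abs_nonneg _
    have hz0 : 0 < z := by
      rcases hz.eq_or_lt with rfl | h
      · simp at h0
      · exact h
    have h1 := linkDiv_tangent hlam hc hint h0 le_rfl
    have h2 := linkDiv_tangent hlam hc hint h0 (show 0 ≤ 2 * z by linarith)
    rw [linkDiv_zero] at h1
    change f (s * z) + _ ≤ 0 at h1
    change f (s * z) + _ ≤ f (2 * z) at h2
    set d := lam (s * z / (c + s * z))
    have h3 : 2 * f (s * z) ≤ s * f (2 * z) := by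
      rcases hs2.eq_or_lt with rfl | hs2
      · exact le_rfl
      have h4 : (2 - s) * f (s * z) ≤ (2 - s) * (d * (s * z)) :=
        mul_le_mul_of_nonneg_left (by linarith) (by linarith)
      have h5 := mul_le_mul_of_nonneg_left h2 hs
      nlinarith
    rcases abs_cases (f (2 * z)) with h | h <;> nlinarith
  -- The coefficients of the upper bound at 2z, plus those of twice the affine lower bound there.
  set K₁ := t₁ + t₂ + (t₃ + M) + 2 * (|f 1| + 2 * |l|) with hK₁
  have hb : ∀ z, 0 ≤ z → ∀ s, 0 ≤ s → s ≤ 2 → |f (s * z)| ≤ K₁ * (|f z| + z + 1) := by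
    intro z hz s hs hs2
    have h1 := hlow (s * z) (by positivity)
    have h2 := hmid z hz s hs hs2
    have h3 := hlow (2 * z) (by positivity)
    have h4 := hup z hz
    have h5 : |l| * (s * z + 1) ≤ |l| * (2 * z + 1) :=
      mul_le_mul_of_nonneg_left (by nlinarith) (abs_nonneg l)
    have e1 := abs_nonneg (f z)
    have e2 := abs_nonneg l
    have e3 := abs_nonneg (f 1)
    have p1 := mul_nonneg e2 hz
    have p2 := mul_nonneg e3 hz
    have p3 := mul_nonneg e2 e1
    have p4 := mul_nonneg e3 e1
    have p5 := mul_nonneg ht₁.le hz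
    have p6 := mul_nonneg ht₂.le e1
    have p7 := mul_nonneg (show 0 ≤ t₃ + M by linarith) hz
    have p8 := mul_nonneg (show 0 ≤ t₃ + M by linarith) e1
    have h6 : |f (2 * z)| ≤ t₁ * |f z| + t₂ * z + (t₃ + M) + (|f 1| + |l| * (2 * z + 1)) := by
      have p9 := mul_nonneg ht₁.le e1
      have p10 := mul_nonneg ht₂.le hz
      rw [abs_le]; constructor <;> linarith
    have h7 : t₁ * |f z| + t₂ * z + (t₃ + M) + 2 * (|f 1| + |l| * (2 * z + 1)) ≤
        K₁ * (|f z| + z + 1) := by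
      rw [hK₁]; nlinarith
    have h8 := abs_nonneg (f (2 * z))
    rw [abs_le]; constructor <;> linarith
  have hK₁0 : 0 ≤ K₁ := by rw [hK₁]; positivity
  refine ⟨4 * K₁, fun z hz s hs hs2 => (hb z hz s hs hs2).trans ?_, fun z hz s hs hs2 => ?_⟩
  · exact mul_le_mul_of_nonneg_right (by linarith) (by positivity)
  -- The derivative at sz is squeezed between the difference quotients of step z/2 on both sides.
  -- The range of s keeps s ± 1/2 in [0, 2]; two values of f and the half step account for the
  -- factor 4.
  · have hsz : 0 < s * z := by nlinarith
    have h1 := linkDiv_tangent hlam hc hint hsz (show 0 ≤ (s + 1 / 2) * z by nlinarith)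
    have h2 := linkDiv_tangent hlam hc hint hsz (show 0 ≤ (s - 1 / 2) * z by nlinarith)
    have b1 := abs_le.1 (hb z hz.le (s + 1 / 2) (by linarith) (by linarith))
    have b2 := abs_le.1 (hb z hz.le (s - 1 / 2) (by linarith) (by linarith))
    have b3 := abs_le.1 (hb z hz.le s (by linarith) (by linarith))
    rw [← hf] at h1 h2
    set d := lam (s * z / (c + s * z))
    have e1 : d * ((s + 1 / 2) * z - s * z) = z * d / 2 := by ring
    have e2 : d * ((s - 1 / 2) * z - s * z) = -(z * d / 2) := by ring
    rw [e1] at h1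
    rw [e2] at h2
    rw [abs_le]; constructor <;> linarith

/-! ### First-order condition for the projection -/

/-- Along an `f`-projection for `f = linkDiv lam c`, the derivative of `f` is, in `L¹`, in the
closure of any space of functions `V` such that the set contains the bounded perturbations of
the projection that are orthogonal to `V`. -/
theorem IsFProjection.inL1Closure_link {Ω : Type*} [MeasurableSpace Ω] {P Q : Measure Ω}
    [IsProbabilityMeasure P] [IsProbabilityMeasure Q] {C : Set (Measure Ω)}
    {lam : ℝ → ℝ} (hlam : RegularLink lam) {c : ℝ} (hc : 0 < c)
    (hint : ∀ z > 0, IntervalIntegrable (fun v => lam (v / (c + v))) volume 0 z)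
    (hgrowth : GrowthCondition (linkDiv lam c)) (hP : IsFProjection (linkDiv lam c) Q C P)
    (V : Submodule ℝ (Ω → ℝ)) (hV : ∀ v ∈ V, Integrable v P)
    (hC : ∀ k : Ω → ℝ, Measurable k → (∀ w, |k w| ≤ 1) → (∀ v ∈ V, ∫ w, k w * v w ∂P = 0) →
      P.withDensity (fun w => ENNReal.ofReal (1 + k w)) ∈ C) :
    InL1Closure P V
      (fun w => lam ((P.rnDeriv Q w).toReal / (c + (P.rnDeriv Q w).toReal))) := by
  classical
  obtain ⟨K, hK1, hK2⟩ := exists_linkDiv_bound hlam hc hint hgrowth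
  set f := linkDiv lam c with hf
  have hPQ : P ≪ Q ∧ Integrable (fun w => f (P.rnDeriv Q w).toReal) Q := by
    by_contra hcon
    exact hP.2.1 (if_neg hcon)
  obtain ⟨hac, hfi⟩ := hPQ
  set r : Ω → ℝ := fun w => (P.rnDeriv Q w).toReal with hr
  have hrm : Measurable r := (Measure.measurable_rnDeriv P Q).ennreal_toReal
  have hr0 : ∀ w, 0 ≤ r w := fun w => ENNReal.toReal_nonneg
  have hri : Integrable r Q := Measure.integrable_toReal_rnDeriv
  -- Extending the derivative by 0 off (0, ∞) makes it measurable on ℝ. The default value is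
  -- harmless: P-almost surely r > 0, and under Q it occurs multiplied by r.
  set ψ : ℝ → ℝ := (Set.Ioi 0).indicator fun v => lam (v / (c + v)) with hψ
  have hψm : Measurable ψ := by
    have := ContinuousOn.measurable_piecewise (s := Set.Ioi (0 : ℝ))
      (continuousOn_link hlam hc) (g := fun _ => (0 : ℝ)) continuousOn_const measurableSet_Ioi
    rwa [hψ, ← Set.piecewise_eq_indicator]
  have hψpos : ∀ v, 0 < v → ψ v = lam (v / (c + v)) := fun v hv =>
    Set.indicator_of_mem (Set.mem_Ioi.2 hv) _
  have hfm : Measurable fun x => f (max 0 x) := by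
    refine Continuous.measurable ?_
    exact (continuousOn_linkDiv hint).comp_continuous (continuous_const.max continuous_id)
      fun x => le_max_left 0 x
  have hbound : Integrable (fun w => K * (|f (r w)| + r w + 1)) Q :=
    ((hfi.abs.add hri).add (integrable_const 1)).const_mul K
  have hfk : ∀ k : Ω → ℝ, Measurable k → (∀ w, |k w| ≤ 1) →
      Integrable (fun w => f ((1 + k w) * r w)) Q := by
    intro k hkm hk
    refine hbound.mono' ?_ (ae_of_all _ fun w => ?_)
    · have h1 : (fun w => f ((1 + k w) * r w)) = fun w => f (max 0 ((1 + k w) * r w)) := by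
        funext w
        have := abs_le.1 (hk w)
        rw [max_eq_right (mul_nonneg (by linarith) (hr0 w))]
      rw [h1]
      exact (hfm.comp ((measurable_const.add hkm).mul hrm)).aestronglyMeasurable
    · have := abs_le.1 (hk w)
      exact hK1 (r w) (hr0 w) _ (by linarith) (by linarith)
  have hψb : ∀ w, ∀ s, 1 / 2 ≤ s → s ≤ 3 / 2 →
      |r w * ψ (s * r w)| ≤ K * (|f (r w)| + r w + 1) := by
    intro w s hs hs'
    rcases (hr0 w).eq_or_lt with h0 | h0
    · rw [← h0]
      simp only [zero_mul, abs_zero]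
      exact (abs_nonneg _).trans (by simpa [← h0] using hK1 (r w) (hr0 w) 1 (by norm_num) (by norm_num))
    · rw [hψpos _ (by nlinarith)]
      exact hK2 (r w) h0 s hs hs'
  have hψi : Integrable (fun w => r w * ψ (r w)) Q := by
    refine hbound.mono' (hrm.mul (hψm.comp hrm)).aestronglyMeasurable (ae_of_all _ fun w => ?_)
    simpa using hψb w 1 (by norm_num) (by norm_num)
  have hae : (fun w => ψ (r w)) =ᵐ[P] fun w => lam (r w / (c + r w)) := by
    filter_upwards [Measure.rnDeriv_pos hac, hac.ae_le (Measure.rnDeriv_lt_top P Q)] with w h1 h2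
    exact hψpos _ (ENNReal.toReal_pos h1.ne' h2.ne)
  have hφi : Integrable (fun w => lam (r w / (c + r w))) P := by
    refine Integrable.congr ?_ hae
    exact (integrable_rnDeriv_smul_iff hac).1 hψi
  have key : ∀ k : Ω → ℝ, Measurable k → (∀ w, |k w| ≤ 1) →
      (∀ v ∈ V, ∫ w, k w * v w ∂P = 0) → 0 ≤ ∫ w, k w * (r w * ψ (r w)) ∂Q := by
    intro k hkm hk hkV
    -- For t ≤ 1/2 the factor 1 + tk stays in [1/2, 3/2], the range in which the derivative is
    -- dominated.
    have step : ∀ t : ℝ, 0 < t → t ≤ 1 / 2 →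
        0 ≤ ∫ w, k w * (r w * ψ ((1 + t * k w) * r w)) ∂Q := by
      intro t ht ht2
      have hkt : ∀ w, |t * k w| ≤ 1 / 2 := fun w => by
        rw [abs_mul, abs_of_pos ht]
        nlinarith [hk w, abs_nonneg (k w)]
      have hmem := hC (fun w => t * k w) (hkm.const_mul t)
        (fun w => (hkt w).trans (by norm_num)) (fun v hv => by
          simp_rw [mul_assoc]
          rw [integral_const_mul, hkV v hv, mul_zero])
      have hle := hP.2.2 _ hmem
      have hm : Measurable fun w => ENNReal.ofReal (1 + t * k w) :=
        (measurable_const.add (hkm.const_mul t)).ennreal_ofReal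
      have hrn : (fun w => f ((P.withDensity fun w => ENNReal.ofReal (1 + t * k w)).rnDeriv
          Q w).toReal) =ᵐ[Q] fun w => f ((1 + t * k w) * r w) := by
        filter_upwards [Measure.rnDeriv_withDensity_left_of_absolutelyContinuous hac
          hm.aemeasurable] with w hw
        have := abs_le.1 (hkt w)
        rw [hw, ENNReal.toReal_mul, ENNReal.toReal_ofReal (by linarith)]
      have hfkt := hfk (fun w => t * k w) (hkm.const_mul t)
        (fun w => (hkt w).trans (by norm_num))
      have h1 : fDivergence f P Q = ((∫ w, f (r w) ∂Q : ℝ) : EReal) := if_pos ⟨hac, hfi⟩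
      have h2 : fDivergence f (P.withDensity fun w => ENNReal.ofReal (1 + t * k w)) Q =
          ((∫ w, f ((1 + t * k w) * r w) ∂Q : ℝ) : EReal) := by
        rw [fDivergence, if_pos ⟨(withDensity_absolutelyContinuous _ _).trans hac,
          (integrable_congr hrn).2 hfkt⟩, integral_congr_ae hrn]
      rw [h1, h2, EReal.coe_le_coe_iff] at hle
      have hint2 : Integrable (fun w => k w * (r w * ψ ((1 + t * k w) * r w))) Q := by
        refine hbound.mono' (hkm.mul (hrm.mul (hψm.comp
          ((measurable_const.add (hkm.const_mul t)).mul hrm)))).aestronglyMeasurable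
          (ae_of_all _ fun w => ?_)
        have := abs_le.1 (hkt w)
        have h3 := hψb w (1 + t * k w) (by linarith) (by linarith)
        rw [Real.norm_eq_abs, abs_mul]
        nlinarith [hk w, abs_nonneg (r w * ψ ((1 + t * k w) * r w))]
      -- The tangent is taken at the perturbed point: there convexity bounds the increment from
      -- above, which is the direction that minimality can use. Where r = 0 both sides vanish.
      have h3 : ∫ w, f ((1 + t * k w) * r w) - f (r w) ∂Q ≤
          ∫ w, t * (k w * (r w * ψ ((1 + t * k w) * r w))) ∂Q := by
        refine integral_mono (hfkt.sub hfi) (hint2.const_mul t) fun w => ?_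
        have := abs_le.1 (hkt w)
        change f ((1 + t * k w) * r w) - f (r w) ≤ t * (k w * (r w * ψ ((1 + t * k w) * r w)))
        rcases (hr0 w).eq_or_lt with h0 | h0
        · rw [← h0]; simp
        · have hpos : 0 < (1 + t * k w) * r w := mul_pos (by linarith) h0
          have h4 := linkDiv_tangent hlam hc hint hpos (hr0 w)
          rw [hψpos _ hpos]
          rw [← hf] at h4
          linarith
      rw [integral_sub hfkt hfi, integral_const_mul] at h3
      exact nonneg_of_mul_nonneg_right (by linarith) ht
    -- Dominated convergence along t = 1/(n + 2), which never exceeds 1/2.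
    have hlim : Filter.Tendsto
        (fun n : ℕ => ∫ w, k w * (r w * ψ ((1 + 1 / ((n : ℝ) + 2) * k w) * r w)) ∂Q)
        Filter.atTop (nhds (∫ w, k w * (r w * ψ (r w)) ∂Q)) := by
      have ht : ∀ n : ℕ, (0 : ℝ) < 1 / ((n : ℝ) + 2) ∧ 1 / ((n : ℝ) + 2) ≤ 1 / 2 := fun n =>
        ⟨by positivity, one_div_le_one_div_of_le (by norm_num) (by linarith [n.cast_nonneg (α := ℝ)])⟩
      refine tendsto_integral_of_dominated_convergence _ (fun n => ?_) hbound
        (fun n => ae_of_all _ fun w => ?_) (ae_of_all _ fun w => ?_)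
      · exact (hkm.mul (hrm.mul (hψm.comp
          ((measurable_const.add (hkm.const_mul _)).mul hrm)))).aestronglyMeasurable
      · have h1 : |1 / ((n : ℝ) + 2) * k w| ≤ 1 / 2 := by
          rw [abs_mul, abs_of_pos (ht n).1]
          nlinarith [hk w, abs_nonneg (k w), (ht n).1, (ht n).2]
        have h2 := abs_le.1 h1
        have h3 := hψb w (1 + 1 / ((n : ℝ) + 2) * k w) (by linarith) (by linarith)
        rw [Real.norm_eq_abs, abs_mul]
        nlinarith [hk w, abs_nonneg (r w * ψ ((1 + 1 / ((n : ℝ) + 2) * k w) * r w))]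
      · rcases (hr0 w).eq_or_lt with h0 | h0
        · rw [← h0]; simp
        refine Filter.Tendsto.const_mul _ (Filter.Tendsto.const_mul _ ?_)
        have hcont : ContinuousAt ψ (r w) := by
          refine ((continuousOn_link hlam hc).continuousAt (Ioi_mem_nhds h0)).congr ?_
          filter_upwards [Ioi_mem_nhds h0] with v hv
          exact (hψpos v hv).symm
        refine hcont.tendsto.comp ?_
        have h1 : Filter.Tendsto (fun n : ℕ => 1 / ((n : ℝ) + 2)) Filter.atTop (nhds 0) :=
          tendsto_const_nhds.div_atTop
            (Filter.tendsto_atTop_add_const_right _ _ tendsto_natCast_atTop_atTop)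
        have h2 := ((h1.mul_const (k w)).const_add 1).mul_const (r w)
        simpa using h2
    refine ge_of_tendsto' hlim fun n => step _ (by positivity) ?_
    exact one_div_le_one_div_of_le (by norm_num) (by linarith [n.cast_nonneg (α := ℝ)])
  refine inL1Closure_of_forall_bounded P V hV _ hφi fun k hkm hk hkV => ?_
  have h1 := key k hkm hk hkV
  have h2 := key (fun w => -k w) hkm.neg (fun w => by rw [abs_neg]; exact hk w) (fun v hv => by
    simp_rw [neg_mul]
    rw [integral_neg, hkV v hv, neg_zero])
  simp_rw [neg_mul] at h2
  rw [integral_neg] at h2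
  have h3 : ∫ w, k w * lam (r w / (c + r w)) ∂P = ∫ w, k w * (r w * ψ (r w)) ∂Q := by
    have h4 : ∫ w, k w * lam (r w / (c + r w)) ∂P = ∫ w, k w * ψ (r w) ∂P := by
      refine integral_congr_ae ?_
      filter_upwards [hae] with w hw
      rw [hw]
    rw [h4, ← integral_rnDeriv_smul hac]
    refine integral_congr_ae (ae_of_all _ fun w => ?_)
    change r w • (k w * ψ (r w)) = _
    rw [smul_eq_mul]
    ring
  change ∫ w, k w * lam (r w / (c + r w)) ∂P = 0
  rw [h3]
  linarith

universe u v

/-! ### Masking and the indicators -/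

section Masking

variable {p : ℕ} {𝒳 : Type u} {𝒴 : Fin p → Type v}

theorem mask_zero (ω : FullData 𝒳 𝒴) : mask 0 ω = reveal (ω.1, ω.2.1) := by
  simp [mask, reveal]

theorem mask_succ (j : Fin p) (ω : FullData 𝒳 𝒴) :
    mask (j + 1) ω = if ω.2.2 j = true then erase j (mask j ω) else mask j ω := by
  refine Prod.ext (by split_ifs <;> rfl) (funext fun i => ?_)
  by_cases hij : i = j
  · subst hij
    by_cases h : ω.2.2 i = true <;> simp [mask, erase, h]
  · have h1 : i ≤ j ↔ i < j := ⟨fun h => lt_of_le_of_ne h hij, le_of_lt⟩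
    by_cases h : ω.2.2 j = true <;> simp [mask, erase, h, h1, Function.update_of_ne hij]

/-- Set the indicator `m_j` to `b`. -/
def setMiss (j : Fin p) (b : Bool) (ω : FullData 𝒳 𝒴) : FullData 𝒳 𝒴 :=
  (ω.1, ω.2.1, Function.update ω.2.2 j b)

/-- The mask at level k reads only the indicators of index below k. This is what allows later
indicators to be integrated out one at a time. -/
theorem mask_setMiss (j : Fin p) (b : Bool) {k : ℕ} (hk : k ≤ j) (ω : FullData 𝒳 𝒴) :
    mask k (setMiss j b ω) = mask k ω := by
  refine Prod.ext rfl (funext fun i => ?_)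
  by_cases hij : i = j
  · subst hij
    simp [mask, setMiss, Nat.not_lt.2 hk]
  · simp [mask, setMiss, Function.update_of_ne hij]

theorem mask_succ_setMiss_true (j : Fin p) (ω : FullData 𝒳 𝒴) :
    mask (j + 1) (setMiss j true ω) = erase j (mask j ω) := by
  rw [mask_succ, mask_setMiss j true le_rfl]
  simp [setMiss]

theorem mask_succ_setMiss_false (j : Fin p) (ω : FullData 𝒳 𝒴) :
    mask (j + 1) (setMiss j false ω) = mask j ω := by
  rw [mask_succ, mask_setMiss j false le_rfl]
  simp [setMiss]

theorem mask_mem_starAt {j : Fin p} {k : ℕ} (hk : j < k) (ω : FullData 𝒳 𝒴) :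
    mask k ω ∈ starAt 𝒳 𝒴 j ↔ ω ∈ missing 𝒳 𝒴 j := by
  by_cases h : ω.2.2 j = true <;> simp [mask, starAt, missing, hk, h]

theorem erase_mem_starAt {i j : Fin p} (hij : i ≠ j) (w : Materialized 𝒳 𝒴) :
    erase j w ∈ starAt 𝒳 𝒴 i ↔ w ∈ starAt 𝒳 𝒴 i := by
  simp [erase, starAt, Function.update_of_ne hij]

/-- Coordinates from j on are never replaced by the placeholder, so the arbitrary filling is not
seen. -/
theorem yPart_mask [∀ i, Nonempty (𝒴 i)] {j : Fin p} {φ : (∀ i, 𝒴 i) → ℝ}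
    (hφ : DependsOn φ {i | j ≤ i}) (ω : FullData 𝒳 𝒴) :
    φ (yPart (mask j ω)) = φ ω.2.1 := by
  refine hφ fun i hi => ?_
  have h1 : ¬ i < j := not_lt.2 hi
  simp [yPart, mask, h1]

variable [MeasurableSpace 𝒳] [∀ i, MeasurableSpace (𝒴 i)]

theorem measurableSet_missing (j : Fin p) : MeasurableSet (missing 𝒳 𝒴 j) :=
  measurableSet_eq_fun ((measurable_pi_apply j).comp (measurable_snd.comp measurable_snd))
    measurable_const

theorem measurableSet_starAt (j : Fin p) : MeasurableSet (starAt 𝒳 𝒴 j) := by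
  have h : starAt 𝒳 𝒴 j = (fun w => w.2 j) ⁻¹' (Set.range Sum.inr) := by
    ext w
    exact ⟨fun h => ⟨(), h.symm⟩, fun ⟨_, h⟩ => h.symm⟩
  rw [h]
  exact ((measurable_pi_apply j).comp measurable_snd) measurableSet_range_inr

theorem measurable_mask (k : ℕ) : Measurable (mask k : FullData 𝒳 𝒴 → Materialized 𝒳 𝒴) := by
  refine measurable_fst.prodMk (measurable_pi_lambda _ fun i => ?_)
  refine Measurable.ite ?_ measurable_const
    (measurable_inl.comp ((measurable_pi_apply i).comp (measurable_fst.comp measurable_snd)))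
  exact (MeasurableSet.const _).inter (measurableSet_missing i)

theorem measurable_erase (j : Fin p) :
    Measurable (erase j : Materialized 𝒳 𝒴 → Materialized 𝒳 𝒴) := by
  refine measurable_fst.prodMk (measurable_pi_lambda _ fun i => ?_)
  by_cases hij : i = j
  · subst hij
    simp
  · simp only [Function.update_of_ne hij]
    exact (measurable_pi_apply i).comp measurable_snd

theorem measurable_reveal :
    Measurable (reveal : 𝒳 × (∀ i, 𝒴 i) → Materialized 𝒳 𝒴) :=
  measurable_fst.prodMk (measurable_pi_lambda _ fun i =>
    measurable_inl.comp ((measurable_pi_apply i).comp measurable_snd))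

theorem measurable_yPart [∀ i, Nonempty (𝒴 i)] :
    Measurable (yPart : Materialized 𝒳 𝒴 → ∀ i, 𝒴 i) :=
  measurable_pi_lambda _ fun i =>
    (Measurable.sumElim measurable_id measurable_const).comp
      ((measurable_pi_apply i).comp measurable_snd)

theorem measurable_setMiss (j : Fin p) (b : Bool) :
    Measurable (setMiss j b : FullData 𝒳 𝒴 → FullData 𝒳 𝒴) := by
  refine measurable_fst.prodMk ((measurable_fst.comp measurable_snd).prodMk
    (measurable_pi_lambda _ fun i => ?_))
  by_cases hij : i = j
  · subst hij
    simp
  · simp only [Function.update_of_ne hij]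
    exact (measurable_pi_apply i).comp (measurable_snd.comp measurable_snd)

end Masking

/-! ### Summation over one indicator -/

section Base

variable {p : ℕ} {𝒳 : Type u} {𝒴 : Fin p → Type v} [MeasurableSpace 𝒳]
  [∀ i, MeasurableSpace (𝒴 i)] (ν : Measure 𝒳) (μ : ∀ i, Measure (𝒴 i))
  [∀ i, SigmaFinite (μ i)]

theorem lintegral_baseMeasure {F : FullData 𝒳 𝒴 → ℝ≥0∞} (hF : Measurable F) :
    ∫⁻ ω, F ω ∂(baseMeasure ν μ) =
      ∑ m, ∫⁻ z, F (z.1, z.2, m) ∂(ν.prod (Measure.pi μ)) := by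
  have hm : ∀ m, Measurable fun z : 𝒳 × (∀ i, 𝒴 i) => F (z.1, z.2, m) := fun m =>
    hF.comp (measurable_fst.prodMk (measurable_snd.prodMk measurable_const))
  rw [← lintegral_finsetSum _ fun m _ => hm m, baseMeasure, lintegral_prod _ hF.aemeasurable,
    lintegral_prod _ (Finset.measurable_sum _ fun m _ => hm m).aemeasurable]
  refine lintegral_congr fun x => ?_
  rw [lintegral_prod (fun z => F (x, z)) (hF.comp measurable_prodMk_left).aemeasurable]
  refine lintegral_congr fun y => ?_
  rw [lintegral_count, tsum_fintype]

/-- The indicator `m_j` is summed out. -/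
theorem two_mul_lintegral_baseMeasure {F : FullData 𝒳 𝒴 → ℝ≥0∞} (hF : Measurable F) (j : Fin p) :
    2 * ∫⁻ ω, F ω ∂(baseMeasure ν μ) =
      ∫⁻ ω, (F (setMiss j true ω) + F (setMiss j false ω)) ∂(baseMeasure ν μ) := by
  -- Flipping m_j permutes the values of m, hence preserves the base measure; the sum over both
  -- values of m_j is F plus F after the flip.
  let flip : FullData 𝒳 𝒴 → FullData 𝒳 𝒴 := fun ω =>
    (ω.1, ω.2.1, Function.update ω.2.2 j (!ω.2.2 j))
  have hflip : ∀ ω, F (setMiss j true ω) + F (setMiss j false ω) = F ω + F (flip ω) := by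
    intro ω
    cases hω : ω.2.2 j
    · rw [add_comm]
      simp only [setMiss, flip, hω, Bool.not_false]
      rw [← hω, Function.update_eq_self]
    · simp only [setMiss, flip, hω, Bool.not_true]
      rw [← hω, Function.update_eq_self]
  have hmeas : Measurable flip := by
    refine measurable_fst.prodMk ((measurable_fst.comp measurable_snd).prodMk
      ((measurable_of_finite fun m : Fin p → Bool => Function.update m j (!m j)).comp
        (measurable_snd.comp measurable_snd)))
  have hinv : Function.Involutive fun m : Fin p → Bool => Function.update m j (!m j) := by
    intro m
    simp
  simp_rw [hflip]
  rw [lintegral_add_left hF, two_mul]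
  congr 1
  rw [lintegral_baseMeasure ν μ hF, lintegral_baseMeasure ν μ (F := fun ω => F (flip ω)) (hF.comp hmeas)]
  exact (Equiv.sum_comp hinv.toPerm fun m =>
    ∫⁻ z, F (z.1, z.2, m) ∂(ν.prod (Measure.pi μ))).symm

end Base

/-! ### Sequential drawing of the indicators -/

section Chain

variable {p : ℕ} {𝒳 : Type u} {𝒴 : Fin p → Type v}

/-- The density `q(x, y) ∏_{j < k} κ_j(m_j | x, y^*_{<j}, y_{≥j})` of `(x, y, m_{<k})`, the other
indicators being filled with fair coins. -/
noncomputable def partialDensity (q : 𝒳 × (∀ i, 𝒴 i) → ℝ≥0∞)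
    (κ : Fin p → Bool → Materialized 𝒳 𝒴 → ℝ≥0∞) (k : ℕ) (ω : FullData 𝒳 𝒴) : ℝ≥0∞ :=
  q (ω.1, ω.2.1) * ∏ j : Fin p, if j.val < k then κ j (ω.2.2 j) (mask j ω) else 2⁻¹

theorem partialDensity_setMiss {q : 𝒳 × (∀ i, 𝒴 i) → ℝ≥0∞}
    {κ : Fin p → Bool → Materialized 𝒳 𝒴 → ℝ≥0∞} (j : Fin p) (b : Bool) {k : ℕ} (hk : k ≤ j) (ω : FullData 𝒳 𝒴) :
    partialDensity q κ k (setMiss j b ω) = partialDensity q κ k ω := by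
  unfold partialDensity
  congr 1
  refine Finset.prod_congr rfl fun i _ => ?_
  by_cases hi : i.val < k
  · have hij : i ≠ j := by rintro rfl; omega
    rw [if_pos hi, if_pos hi, mask_setMiss j b (by omega)]
    simp [setMiss, Function.update_of_ne hij]
  · rw [if_neg hi, if_neg hi]

/-- The kernel replaces a fair coin, and the 2 cancels the weight of that coin. -/
theorem partialDensity_succ {q : 𝒳 × (∀ i, 𝒴 i) → ℝ≥0∞}
    {κ : Fin p → Bool → Materialized 𝒳 𝒴 → ℝ≥0∞} (j : Fin p) (ω : FullData 𝒳 𝒴) :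
    partialDensity q κ (j + 1) ω =
      2 * (partialDensity q κ j ω * κ j (ω.2.2 j) (mask j ω)) := by
  unfold partialDensity
  rw [← Finset.mul_prod_erase _ _ (Finset.mem_univ j),
    ← Finset.mul_prod_erase (s := Finset.univ)
      (fun i : Fin p => if i.val < j.val then κ i (ω.2.2 i) (mask i ω) else 2⁻¹)
      (Finset.mem_univ j)]
  have h1 : ∏ i ∈ Finset.univ.erase j, (if i.val < j.val + 1 then κ i (ω.2.2 i) (mask i ω)
      else (2⁻¹ : ℝ≥0∞)) = ∏ i ∈ Finset.univ.erase j,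
        (if i.val < j.val then κ i (ω.2.2 i) (mask i ω) else 2⁻¹) := by
    refine Finset.prod_congr rfl fun i hi => ?_
    have : i.val ≠ j.val := fun h => (Finset.mem_erase.1 hi).1 (Fin.ext h)
    have h2 : i.val < j.val + 1 ↔ i.val < j.val := by omega
    simp only [h2]
  rw [h1, if_pos (Nat.lt_succ_self _), if_neg (lt_irrefl _)]
  set R := ∏ i ∈ Finset.univ.erase j, (if i.val < j.val then κ i (ω.2.2 i) (mask i ω)
      else (2⁻¹ : ℝ≥0∞))
  have h3 : (2 : ℝ≥0∞) * 2⁻¹ = 1 := ENNReal.mul_inv_cancel (by norm_num) (by norm_num)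
  calc q (ω.1, ω.2.1) * (κ j (ω.2.2 j) (mask j ω) * R)
      = (2 * 2⁻¹) * (q (ω.1, ω.2.1) * (κ j (ω.2.2 j) (mask j ω) * R)) := by rw [h3, one_mul]
    _ = 2 * (q (ω.1, ω.2.1) * (2⁻¹ * R) * κ j (ω.2.2 j) (mask j ω)) := by ring

variable [MeasurableSpace 𝒳] [∀ i, MeasurableSpace (𝒴 i)]

/-- The distribution with density `partialDensity`. -/
noncomputable def partialLaw (ν : Measure 𝒳) (μ : ∀ i, Measure (𝒴 i))
    (q : 𝒳 × (∀ i, 𝒴 i) → ℝ≥0∞) (κ : Fin p → Bool → Materialized 𝒳 𝒴 → ℝ≥0∞) (k : ℕ) :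
    Measure (FullData 𝒳 𝒴) :=
  (baseMeasure ν μ).withDensity (partialDensity q κ k)

variable (ν : Measure 𝒳) (μ : ∀ i, Measure (𝒴 i)) [∀ i, SigmaFinite (μ i)]
  {q : 𝒳 × (∀ i, 𝒴 i) → ℝ≥0∞} {κ : Fin p → Bool → Materialized 𝒳 𝒴 → ℝ≥0∞}

theorem measurable_kernel_mask (hκ : ∀ j b, Measurable (κ j b)) (j : Fin p) :
    Measurable fun ω : FullData 𝒳 𝒴 => κ j (ω.2.2 j) (mask j ω) := by
  classical
  have h : (fun ω : FullData 𝒳 𝒴 => κ j (ω.2.2 j) (mask j ω)) =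
      (missing 𝒳 𝒴 j).piecewise (fun ω => κ j true (mask j ω))
        (fun ω => κ j false (mask j ω)) := by
    funext ω
    by_cases hω : ω.2.2 j = true
    · rw [Set.piecewise_eq_of_mem _ _ _ (show ω ∈ missing 𝒳 𝒴 j from hω), hω]
    · rw [Set.piecewise_eq_of_notMem _ _ _ (show ω ∉ missing 𝒳 𝒴 j from hω),
        Bool.eq_false_of_not_eq_true hω]
  rw [h]
  exact Measurable.piecewise (measurableSet_missing j) ((hκ j true).comp (measurable_mask _))
    ((hκ j false).comp (measurable_mask _))

theorem measurable_partialDensity (hq : Measurable q) (hκ : ∀ j b, Measurable (κ j b)) (k : ℕ) :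
    Measurable (partialDensity q κ k) := by
  refine (hq.comp (measurable_fst.prodMk (measurable_fst.comp measurable_snd))).mul
    (Finset.measurable_prod _ fun j _ => ?_)
  by_cases hj : j.val < k
  · simp only [hj, if_true]
    exact measurable_kernel_mask hκ j
  · simp only [hj, if_false]
    exact measurable_const

/-- The indicator `m_j` is drawn from `κ_j`. -/
theorem lintegral_partialLaw_succ (hq : Measurable q) (hκ : ∀ j b, Measurable (κ j b))
    (j : Fin p) {F : FullData 𝒳 𝒴 → ℝ≥0∞} (hF : Measurable F) :
    ∫⁻ ω, F ω ∂(partialLaw ν μ q κ (j + 1)) =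
      ∫⁻ ω, (κ j true (mask j ω) * F (setMiss j true ω) +
        κ j false (mask j ω) * F (setMiss j false ω)) ∂(partialLaw ν μ q κ j) := by
  have hd := measurable_partialDensity hq hκ
  have hk := measurable_kernel_mask hκ j
  have hG : ∀ b, Measurable fun ω : FullData 𝒳 𝒴 => κ j b (mask j ω) * F (setMiss j b ω) :=
    fun b => ((hκ j b).comp (measurable_mask _)).mul (hF.comp (measurable_setMiss j b))
  rw [partialLaw, partialLaw, lintegral_withDensity_eq_lintegral_mul _ (hd _) hF,
    lintegral_withDensity_eq_lintegral_mul (g := fun ω => κ j true (mask j ω) *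
      F (setMiss j true ω) + κ j false (mask j ω) * F (setMiss j false ω)) _ (hd _)
      ((hG true).add (hG false))]
  have h1 : ∀ ω, (partialDensity q κ (j + 1) * F) ω =
      2 * (partialDensity q κ j ω * κ j (ω.2.2 j) (mask j ω) * F ω) := fun ω => by
    rw [Pi.mul_apply, partialDensity_succ, mul_assoc]
  have hm : Measurable fun ω => partialDensity q κ j ω * κ j (ω.2.2 j) (mask j ω) * F ω :=
    ((hd j).mul hk).mul hF
  simp_rw [h1]
  -- The 2 left by the coin is exactly the one required to sum out m_j.
  rw [lintegral_const_mul _ hm, two_mul_lintegral_baseMeasure ν μ hm j]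
  refine lintegral_congr fun ω => ?_
  simp only [partialDensity_setMiss j _ le_rfl, mask_setMiss j _ le_rfl, Pi.mul_apply]
  simp only [setMiss, Function.update_self]
  ring

/-- Later indicators do not change the law of the earlier variables. -/
theorem lintegral_partialLaw_succ_of_invariant (hq : Measurable q)
    (hκ : ∀ j b, Measurable (κ j b)) (j : Fin p)
    (hsum : ∀ᵐ w ∂(partialLaw ν μ q κ j).map (mask j), κ j true w + κ j false w = 1)
    {F : FullData 𝒳 𝒴 → ℝ≥0∞} (hF : Measurable F) (hinv : ∀ b ω, F (setMiss j b ω) = F ω) :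
    ∫⁻ ω, F ω ∂(partialLaw ν μ q κ (j + 1)) = ∫⁻ ω, F ω ∂(partialLaw ν μ q κ j) := by
  rw [lintegral_partialLaw_succ ν μ hq hκ j hF]
  refine lintegral_congr_ae ?_
  filter_upwards [ae_of_ae_map (measurable_mask _).aemeasurable hsum] with ω hω
  rw [hinv, hinv, ← add_mul, hω, one_mul]

/-- Each kernel of index at least k has total mass one where it is used, so drawing these indicators
does not affect an integrand that ignores them. -/
theorem lintegral_partialLaw_of_invariant (hq : Measurable q) (hκ : ∀ j b, Measurable (κ j b))
    (hsum : ∀ j : Fin p, ∀ᵐ w ∂(partialLaw ν μ q κ j).map (mask j), κ j true w + κ j false w = 1)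
    {F : FullData 𝒳 𝒴 → ℝ≥0∞} (hF : Measurable F) {k : ℕ}
    (hinv : ∀ j : Fin p, k ≤ j → ∀ b ω, F (setMiss j b ω) = F ω) {l : ℕ} (hkl : k ≤ l)
    (hl : l ≤ p) :
    ∫⁻ ω, F ω ∂(partialLaw ν μ q κ l) = ∫⁻ ω, F ω ∂(partialLaw ν μ q κ k) := by
  induction l, hkl using Nat.le_induction with
  | base => rfl
  | succ l hkl ih =>
    rw [← ih (by omega)]
    exact lintegral_partialLaw_succ_of_invariant ν μ hq hκ ⟨l, hl⟩ (hsum _) hF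
      (hinv ⟨l, hl⟩ hkl)

/-- Under the full law, `κ_j` is the conditional distribution of `m_j` given
`(x, y, m_{<j})`. -/
theorem setLIntegral_partialLaw_missing (hq : Measurable q) (hκ : ∀ j b, Measurable (κ j b))
    (hsum : ∀ j : Fin p, ∀ᵐ w ∂(partialLaw ν μ q κ j).map (mask j), κ j true w + κ j false w = 1)
    (j : Fin p) {F : FullData 𝒳 𝒴 → ℝ≥0∞} (hF : Measurable F)
    (hinv : ∀ i : Fin p, j ≤ i → ∀ b ω, F (setMiss i b ω) = F ω) :
    ∫⁻ ω in missing 𝒳 𝒴 j, F ω ∂(partialLaw ν μ q κ p) =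
      ∫⁻ ω, κ j true (mask j ω) * F ω ∂(partialLaw ν μ q κ p) := by
  have hind : Measurable ((missing 𝒳 𝒴 j).indicator F) := hF.indicator (measurableSet_missing j)
  have hk : Measurable fun ω : FullData 𝒳 𝒴 => κ j true (mask j ω) * F ω :=
    ((hκ j true).comp (measurable_mask _)).mul hF
  -- The left integrand involves no indicator after m_j, so it can be evaluated at stage j + 1; the
  -- right one does not involve m_j either, so stage j suffices. The two stages differ by one draw.
  rw [← lintegral_indicator (measurableSet_missing j),
    lintegral_partialLaw_of_invariant ν μ hq hκ hsum hind (k := j + 1) (fun i hi b ω => ?_)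
      (Nat.succ_le_of_lt j.2) le_rfl,
    lintegral_partialLaw_of_invariant ν μ hq hκ hsum hk (k := j) (fun i hi b ω => ?_)
      j.2.le le_rfl,
    lintegral_partialLaw_succ ν μ hq hκ j hind]
  · refine lintegral_congr fun ω => ?_
    have h1 : setMiss j true ω ∈ missing 𝒳 𝒴 j := by simp [setMiss, missing]
    have h2 : setMiss j false ω ∉ missing 𝒳 𝒴 j := by simp [setMiss, missing]
    rw [Set.indicator_of_mem h1, Set.indicator_of_notMem h2, hinv j le_rfl, mul_zero, add_zero]
  · rw [mask_setMiss i b hi, hinv i hi]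
  · have hij : j ≠ i := by rintro rfl; omega
    have h1 : setMiss i b ω ∈ missing 𝒳 𝒴 j ↔ ω ∈ missing 𝒳 𝒴 j := by
      simp [setMiss, missing, Function.update_of_ne hij]
    have h2 := hinv i (by rw [Fin.le_def]; omega) b ω
    by_cases h : ω ∈ missing 𝒳 𝒴 j
    · rw [Set.indicator_of_mem h, Set.indicator_of_mem (h1.2 h), h2]
    · rw [Set.indicator_of_notMem h, Set.indicator_of_notMem (mt h1.1 h)]

end Chain

theorem smul_cond_eq_restrict {Ω : Type*} [MeasurableSpace Ω] {R : Measure Ω} [IsFiniteMeasure R]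
    {s : Set Ω} (hs : R s ≠ 0) : R s • cond R s = R.restrict s := by
  rw [ProbabilityTheory.cond, smul_smul, ENNReal.mul_inv_cancel hs (measure_ne_top R s), one_smul]

theorem map_erase_restrict_starAt {p : ℕ} {𝒳 : Type u} {𝒴 : Fin p → Type v} [MeasurableSpace 𝒳]
    [∀ i, MeasurableSpace (𝒴 i)]
    (R : Measure (Materialized 𝒳 𝒴)) (j : Fin p) :
    (R.restrict (starAt 𝒳 𝒴 j)).map (erase j) = R.restrict (starAt 𝒳 𝒴 j) := by
  conv_rhs => rw [← Measure.map_id (μ := R.restrict (starAt 𝒳 𝒴 j))]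
  refine Measure.map_congr ?_
  filter_upwards [ae_restrict_mem (measurableSet_starAt j)] with w hw
  refine Prod.ext rfl ?_
  change Function.update w.2 j (Sum.inr ()) = w.2
  rw [← (show w.2 j = Sum.inr () from hw), Function.update_eq_self]

theorem odds_pos {π : ℝ} (h0 : 0 < π) (h1 : π < 1) : 0 < odds π :=
  div_pos (sub_pos.2 h1) h0

theorem measurable_stepKernel {p : ℕ} {𝒳 : Type u} {𝒴 : Fin p → Type v} [MeasurableSpace 𝒳]
    [∀ i, MeasurableSpace (𝒴 i)] {D : Fin (p + 1) → Measure (Materialized 𝒳 𝒴)}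
    {P : Fin p → Measure (Materialized 𝒳 𝒴)} (j : Fin p) (b : Bool) : Measurable (stepKernel D P j b) := by
  cases b
  · exact Measure.measurable_rnDeriv ((1 - D j.succ (starAt 𝒳 𝒴 j)) •
      cond (D j.succ) (starAt 𝒳 𝒴 j)ᶜ) (D j.castSucc)
  · exact Measure.measurable_rnDeriv (D j.succ (starAt 𝒳 𝒴 j) • P j) (D j.castSucc)

/-! ### Laws and kernels of the construction -/

section Run

variable {p : ℕ} {𝒳 : Type u} {𝒴 : Fin p → Type v} [MeasurableSpace 𝒳]
  [∀ i, MeasurableSpace (𝒴 i)] [∀ i, Nonempty (𝒴 i)] {lam : ℝ → ℝ}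
  {U : Set ((∀ i, 𝒴 i) → ℝ)} {obs : Measure (Materialized 𝒳 𝒴)}
  {e : ((∀ i, 𝒴 i) → ℝ) → ℝ} {D : Fin (p + 1) → Measure (Materialized 𝒳 𝒴)}
  {P : Fin p → Measure (Materialized 𝒳 𝒴)}

theorem IsRun.isProbabilityMeasure_projection (hrun : IsRun lam U obs e D P) (j : Fin p) :
    IsProbabilityMeasure (P j) :=
  (hrun.projection j).1.1

theorem IsRun.projection_absolutelyContinuous (hrun : IsRun lam U obs e D P) (j : Fin p) :
    P j ≪ cond (D j.succ) (starAt 𝒳 𝒴 j)ᶜ := by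
  by_contra hcon
  exact (hrun.projection j).2.1 (if_neg fun h => hcon h.1)

variable [IsProbabilityMeasure obs]

/-- The laws occurring in the construction are probability measures that keep the observed law of
the earlier indicators. -/
theorem IsRun.invariants (hrun : IsRun lam U obs e D P)
    (h0 : ∀ j, obs (starAt 𝒳 𝒴 j) ≠ 0) (h1 : ∀ j, obs (starAt 𝒳 𝒴 j) ≠ 1) (k : Fin (p + 1)) :
    IsProbabilityMeasure (D k) ∧
      ∀ j : Fin p, j.val < k.val → D k (starAt 𝒳 𝒴 j) = obs (starAt 𝒳 𝒴 j) := by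
  induction k using Fin.reverseInduction with
  | last =>
    rw [hrun.input]
    exact ⟨inferInstance, fun _ _ => rfl⟩
  | cast j ih =>
    obtain ⟨hprob, hstar⟩ := ih
    have ha : D j.succ (starAt 𝒳 𝒴 j) = obs (starAt 𝒳 𝒴 j) := hstar j (by simp)
    have hc : 1 - D j.succ (starAt 𝒳 𝒴 j) = D j.succ (starAt 𝒳 𝒴 j)ᶜ :=
      (prob_compl_eq_one_sub (measurableSet_starAt j)).symm
    have hc0 : D j.succ (starAt 𝒳 𝒴 j)ᶜ ≠ 0 := by
      rw [Ne, prob_compl_eq_zero_iff (measurableSet_starAt j), ha]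
      exact h1 j
    have ha0 : D j.succ (starAt 𝒳 𝒴 j) ≠ 0 := by rw [ha]; exact h0 j
    have := hrun.isProbabilityMeasure_projection j
    have hmix := hrun.mixture j
    rw [hc, smul_cond_eq_restrict hc0] at hmix
    -- After y_j is erased, step j changes nothing: the part given M_j = 1 has the matched marginal,
    -- and the part given M_j = 0 is kept as it is. Total mass and the events M_i = 1 for i < j are
    -- visible after erasure, hence preserved.
    have hmap : (D j.castSucc).map (erase j) = (D j.succ).map (erase j) := by
      rw [hmix, Measure.map_add _ _ (measurable_erase j), Measure.map_smul,
        (hrun.projection j).1.2.2.1, smul_cond_eq_restrict ha0]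
      conv_rhs => rw [← Measure.restrict_add_restrict_compl (μ := D j.succ)
        (measurableSet_starAt j), Measure.map_add _ _ (measurable_erase j),
        map_erase_restrict_starAt]
    refine ⟨⟨?_⟩, fun i hi => ?_⟩
    · have h := congrArg (fun R => R Set.univ) hmap
      simpa [Measure.map_apply (measurable_erase j) MeasurableSet.univ] using h
    · have hij : i ≠ j := by
        rintro rfl
        exact lt_irrefl _ hi
      have hpre : erase j ⁻¹' (starAt 𝒳 𝒴 i) = starAt 𝒳 𝒴 i :=
        Set.ext fun w => erase_mem_starAt hij w
      have h := congrArg (fun R => R (starAt 𝒳 𝒴 i)) hmap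
      simp only [Measure.map_apply (measurable_erase j) (measurableSet_starAt i), hpre] at h
      rw [h]
      refine hstar i ?_
      have : i.val < j.val := hi
      simp only [Fin.val_succ]
      omega

/-- It identifies the π_j recomputed in step j with the observed one, so that the odds are those for
which integrability and growth are assumed. -/
theorem IsRun.measure_starAt (hrun : IsRun lam U obs e D P)
    (h0 : ∀ j, obs (starAt 𝒳 𝒴 j) ≠ 0) (h1 : ∀ j, obs (starAt 𝒳 𝒴 j) ≠ 1) (j : Fin p) :
    D j.succ (starAt 𝒳 𝒴 j) = obs (starAt 𝒳 𝒴 j) :=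
  (hrun.invariants h0 h1 j.succ).2 j (by simp)

/-- The step of the construction, with the law given `M_j = 0` written as a restriction. -/
theorem IsRun.mixture_restrict (hrun : IsRun lam U obs e D P)
    (h0 : ∀ j, obs (starAt 𝒳 𝒴 j) ≠ 0) (h1 : ∀ j, obs (starAt 𝒳 𝒴 j) ≠ 1) (j : Fin p) :
    (1 - D j.succ (starAt 𝒳 𝒴 j)) • cond (D j.succ) (starAt 𝒳 𝒴 j)ᶜ =
        (D j.succ).restrict (starAt 𝒳 𝒴 j)ᶜ ∧
      D j.castSucc = D j.succ (starAt 𝒳 𝒴 j) • P j + (D j.succ).restrict (starAt 𝒳 𝒴 j)ᶜ ∧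
      D j.succ (starAt 𝒳 𝒴 j)ᶜ ≠ 0 := by
  have := (hrun.invariants h0 h1 j.succ).1
  have hc : 1 - D j.succ (starAt 𝒳 𝒴 j) = D j.succ (starAt 𝒳 𝒴 j)ᶜ :=
    (prob_compl_eq_one_sub (measurableSet_starAt j)).symm
  have hc0 : D j.succ (starAt 𝒳 𝒴 j)ᶜ ≠ 0 := by
    rw [Ne, prob_compl_eq_zero_iff (measurableSet_starAt j), hrun.measure_starAt h0 h1 j]
    exact h1 j
  have h2 := smul_cond_eq_restrict hc0
  rw [← hc] at h2
  exact ⟨h2, by rw [← h2]; exact hrun.mixture j, hc0⟩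

/-- As a summand of the mixture, π_j `P j` is dominated by it and is recovered from its
Radon-Nikodym derivative. -/
theorem IsRun.stepKernel_true (hrun : IsRun lam U obs e D P)
    (h0 : ∀ j, obs (starAt 𝒳 𝒴 j) ≠ 0) (h1 : ∀ j, obs (starAt 𝒳 𝒴 j) ≠ 1) (j : Fin p) :
    (D j.castSucc).withDensity (stepKernel D P j true) = D j.succ (starAt 𝒳 𝒴 j) • P j := by
  have := (hrun.invariants h0 h1 j.castSucc).1
  have := (hrun.invariants h0 h1 j.succ).1
  have := hrun.isProbabilityMeasure_projection j
  have := Measure.smul_finite (P j) (measure_ne_top (D j.succ) (starAt 𝒳 𝒴 j))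
  have hle : D j.succ (starAt 𝒳 𝒴 j) • P j ≤ D j.castSucc := by
    rw [hrun.mixture j]
    exact Measure.le_add_right le_rfl
  have h : stepKernel D P j true =
      (D j.succ (starAt 𝒳 𝒴 j) • P j).rnDeriv (D j.castSucc) := rfl
  rw [h, Measure.withDensity_rnDeriv_eq _ _ (Measure.absolutelyContinuous_of_le hle)]

theorem IsRun.stepKernel_false (hrun : IsRun lam U obs e D P)
    (h0 : ∀ j, obs (starAt 𝒳 𝒴 j) ≠ 0) (h1 : ∀ j, obs (starAt 𝒳 𝒴 j) ≠ 1) (j : Fin p) :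
    (D j.castSucc).withDensity (stepKernel D P j false) =
      (D j.succ).restrict (starAt 𝒳 𝒴 j)ᶜ := by
  have := (hrun.invariants h0 h1 j.castSucc).1
  have := (hrun.invariants h0 h1 j.succ).1
  obtain ⟨h2, h3, -⟩ := hrun.mixture_restrict h0 h1 j
  have hle : (D j.succ).restrict (starAt 𝒳 𝒴 j)ᶜ ≤ D j.castSucc := by
    rw [h3]
    exact Measure.le_add_left le_rfl
  have h : stepKernel D P j false =
      ((D j.succ).restrict (starAt 𝒳 𝒴 j)ᶜ).rnDeriv (D j.castSucc) := by rw [← h2]; rfl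
  rw [h, Measure.withDensity_rnDeriv_eq _ _ (Measure.absolutelyContinuous_of_le hle)]

/-- The two summands add up to the mixture, whose density with respect to itself is 1. -/
theorem IsRun.stepKernel_sum (hrun : IsRun lam U obs e D P)
    (h0 : ∀ j, obs (starAt 𝒳 𝒴 j) ≠ 0) (h1 : ∀ j, obs (starAt 𝒳 𝒴 j) ≠ 1) (j : Fin p) :
    ∀ᵐ w ∂(D j.castSucc), stepKernel D P j true w + stepKernel D P j false w = 1 := by
  have := (hrun.invariants h0 h1 j.castSucc).1
  have h : (D j.castSucc).withDensity
      (fun w => stepKernel D P j true w + stepKernel D P j false w) =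
        (D j.castSucc).withDensity 1 := by
    rw [withDensity_one]
    refine Eq.trans (withDensity_add_left (measurable_stepKernel j true)
      (stepKernel D P j false)) ?_
    rw [hrun.stepKernel_true h0 h1 j, hrun.stepKernel_false h0 h1 j,
      ← (hrun.mixture_restrict h0 h1 j).2.1]
  exact (withDensity_eq_iff_of_sigmaFinite ((measurable_stepKernel j true).add
    (measurable_stepKernel j false)).aemeasurable measurable_one.aemeasurable).1 h

/-- The conditional probability of `M_j = 1` in terms of the density ratio. -/
theorem IsRun.toReal_stepKernel_true (hrun : IsRun lam U obs e D P)
    (h0 : ∀ j, obs (starAt 𝒳 𝒴 j) ≠ 0) (h1 : ∀ j, obs (starAt 𝒳 𝒴 j) ≠ 1) (j : Fin p) :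
    ∀ᵐ w ∂(D j.castSucc), (stepKernel D P j true w).toReal =
      ((P j).rnDeriv (cond (D j.succ) (starAt 𝒳 𝒴 j)ᶜ) w).toReal /
        (odds ((D j.succ).real (starAt 𝒳 𝒴 j)) +
          ((P j).rnDeriv (cond (D j.succ) (starAt 𝒳 𝒴 j)ᶜ) w).toReal) := by
  have := (hrun.invariants h0 h1 j.castSucc).1
  have := (hrun.invariants h0 h1 j.succ).1
  have := hrun.isProbabilityMeasure_projection j
  obtain ⟨-, -, hc0⟩ := hrun.mixture_restrict h0 h1 j
  have := cond_isProbabilityMeasure hc0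
  have hac := hrun.projection_absolutelyContinuous j
  have hmix := hrun.mixture j
  have hdef : stepKernel D P j true =
      (D j.succ (starAt 𝒳 𝒴 j) • P j).rnDeriv (D j.castSucc) := rfl
  have ha0 : D j.succ (starAt 𝒳 𝒴 j) ≠ 0 := by rw [hrun.measure_starAt h0 h1 j]; exact h0 j
  have ha1 : D j.succ (starAt 𝒳 𝒴 j) ≠ 1 := by rw [hrun.measure_starAt h0 h1 j]; exact h1 j
  have haR : (D j.succ).real (starAt 𝒳 𝒴 j) = (D j.succ (starAt 𝒳 𝒴 j)).toReal := rfl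
  rw [hdef, haR]
  set Q := cond (D j.succ) (starAt 𝒳 𝒴 j)ᶜ
  have hale : D j.succ (starAt 𝒳 𝒴 j) ≤ 1 := prob_le_one
  set a := D j.succ (starAt 𝒳 𝒴 j)
  have hat : a ≠ ⊤ := (hale.trans_lt ENNReal.one_lt_top).ne
  have hlt : a < 1 := lt_of_le_of_ne hale ha1
  set ρ := (P j).rnDeriv Q
  have hρm : Measurable ρ := Measure.measurable_rnDeriv _ _
  have hs0 : ∀ w, a * ρ w + (1 - a) ≠ 0 := fun w h =>
    (tsub_pos_of_lt hlt).ne' (add_eq_zero.1 h).2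
  -- Both components are written over the law Q given M_j = 0. The quotient of densities is then aρ
  -- / (aρ + 1 - a), that is ρ / (c + ρ) with c the odds (1 - a) / a.
  have hDQ : D j.castSucc = Q.withDensity fun w => a * ρ w + (1 - a) := by
    have h2 : (Q.withDensity fun w => a * ρ w + (1 - a)) =
        Q.withDensity (fun w => a * ρ w) + Q.withDensity (fun _ => 1 - a) :=
      withDensity_add_left (hρm.const_mul a) _
    have h3 : Q.withDensity (fun w => a * ρ w) = a • P j := by
      have h4 := withDensity_smul (μ := Q) a hρm
      rw [Measure.withDensity_rnDeriv_eq _ _ hac] at h4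
      exact h4
    rw [h2, h3, withDensity_const, hmix]
  have hDac : D j.castSucc ≪ Q := by
    rw [hDQ]
    exact withDensity_absolutelyContinuous _ _
  have := Measure.smul_finite (P j) hat
  have h5 := Measure.rnDeriv_withDensity_right_of_absolutelyContinuous
    (μ := a • P j) (ν := Q) (f := fun w => a * ρ w + (1 - a)) (hac.smul_left a)
    ((hρm.const_mul a).add_const _).aemeasurable (ae_of_all _ hs0)
    (by
      filter_upwards [Measure.rnDeriv_lt_top (P j) Q] with w hw
      exact ENNReal.add_ne_top.2 ⟨ENNReal.mul_ne_top hat hw.ne, by simp⟩)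
  rw [← hDQ] at h5
  filter_upwards [hDac.ae_le h5, hDac.ae_le (Measure.rnDeriv_smul_left_of_ne_top (P j) Q hat),
    hDac.ae_le (Measure.rnDeriv_lt_top (P j) Q)] with w h6 h7 h8
  rw [h6, h7, Pi.smul_apply, smul_eq_mul, ENNReal.toReal_mul, ENNReal.toReal_inv,
    ENNReal.toReal_add (ENNReal.mul_ne_top hat h8.ne) (by simp), ENNReal.toReal_mul,
    ENNReal.toReal_sub_of_le hale ENNReal.one_ne_top, ENNReal.toReal_one]
  have hapos : 0 < a.toReal := ENNReal.toReal_pos ha0 hat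
  have haltR : a.toReal < 1 := by
    have := (ENNReal.toReal_lt_toReal hat ENNReal.one_ne_top).2 hlt
    simpa using this
  have hr0 : 0 ≤ (ρ w).toReal := ENNReal.toReal_nonneg
  change (a.toReal * (ρ w).toReal + (1 - a.toReal))⁻¹ * (a.toReal * (ρ w).toReal) =
    (ρ w).toReal / ((1 - a.toReal) / a.toReal + (ρ w).toReal)
  have hne : a.toReal * (ρ w).toReal + (1 - a.toReal) ≠ 0 := by
    have := mul_nonneg hapos.le hr0
    linarith
  have hne' : (1 - a.toReal) / a.toReal + (ρ w).toReal ≠ 0 := by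
    have : 0 < (1 - a.toReal) / a.toReal := div_pos (by linarith) hapos
    linarith
  have e1 : (1 - a.toReal) / a.toReal + (ρ w).toReal =
      (a.toReal * (ρ w).toReal + (1 - a.toReal)) / a.toReal := by
    field_simp
    ring
  rw [e1, div_div_eq_mul_div, div_eq_mul_inv]
  ring

variable (ν : Measure 𝒳) (μ : ∀ i, Measure (𝒴 i)) [∀ i, SigmaFinite (μ i)]
  {q : 𝒳 × (∀ i, 𝒴 i) → ℝ≥0∞}

/-- The partial laws have the marginals of the construction. -/
theorem IsRun.map_mask_partialLaw (hrun : IsRun lam U obs e D P)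
    (h0 : ∀ j, obs (starAt 𝒳 𝒴 j) ≠ 0) (h1 : ∀ j, obs (starAt 𝒳 𝒴 j) ≠ 1)
    (hq : Measurable q) (hqD : ((ν.prod (Measure.pi μ)).withDensity q).map reveal = D 0)
    (k : Fin (p + 1)) :
    (partialLaw ν μ q (stepKernel D P) k).map (mask k) = D k := by
  have hκ : ∀ j b, Measurable (stepKernel D P j b) := fun j b => measurable_stepKernel j b
  induction k using Fin.induction with
  | zero =>
    refine Measure.ext_of_lintegral _ fun F hF => ?_
    rw [← hqD, lintegral_map hF measurable_reveal, lintegral_map hF (measurable_mask _)]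
    have hd := measurable_partialDensity hq hκ 0
    change ∫⁻ ω, F (mask 0 ω) ∂(partialLaw ν μ q (stepKernel D P) 0) = _
    rw [partialLaw, lintegral_withDensity_eq_lintegral_mul (g := fun ω => F (mask 0 ω)) _ hd
        (hF.comp (measurable_mask 0)),
      lintegral_baseMeasure ν μ (F := partialDensity q (stepKernel D P) 0 * fun ω => F (mask 0 ω))
        (hd.mul (hF.comp (measurable_mask 0))),
      lintegral_withDensity_eq_lintegral_mul (g := fun z => F (reveal z)) _ hq
        (hF.comp measurable_reveal)]
    -- At level 0 every indicator is still a fair coin: each of the 2^p values of m has weight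
    -- 2^{-p}.
    have h2 : ∀ m : Fin p → Bool, ∫⁻ z : 𝒳 × (∀ i, 𝒴 i), (partialDensity q (stepKernel D P) 0 *
        fun ω => F (mask 0 ω)) (z.1, z.2, m) ∂(ν.prod (Measure.pi μ)) =
        2⁻¹ ^ p * ∫⁻ z, (q * fun z => F (reveal z)) z ∂(ν.prod (Measure.pi μ)) := by
      intro m
      rw [← lintegral_const_mul (f := q * fun z => F (reveal z)) _
        (hq.mul (hF.comp measurable_reveal))]
      refine lintegral_congr fun z => ?_
      simp only [Pi.mul_apply, partialDensity, mask_zero, Nat.not_lt_zero, if_false,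
        Finset.prod_const, Finset.card_univ, Fintype.card_fin, Prod.mk.eta]
      ring
    refine (Finset.sum_congr rfl fun m _ => h2 m).trans ?_
    rw [Finset.sum_const, Finset.card_univ, Fintype.card_fun, Fintype.card_fin, Fintype.card_bool,
      nsmul_eq_mul, ← mul_assoc, Nat.cast_pow, ← mul_pow, Nat.cast_ofNat,
      ENNReal.mul_inv_cancel (by norm_num) (by norm_num), one_pow, one_mul]
  | succ j ih =>
    have := (hrun.invariants h0 h1 j.succ).1
    have ih' : (partialLaw ν μ q (stepKernel D P) j).map (mask j) = D j.castSucc := ih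
    refine Measure.ext_of_lintegral _ fun F hF => ?_
    change ∫⁻ w, F w ∂((partialLaw ν μ q (stepKernel D P) (j + 1)).map (mask (j + 1))) = _
    rw [lintegral_map hF (measurable_mask _),
      lintegral_partialLaw_succ ν μ hq hκ j (F := fun ω => F (mask (j + 1) ω))
        (hF.comp (measurable_mask _))]
    simp only [mask_succ_setMiss_true, mask_succ_setMiss_false]
    have hm1 : Measurable fun w => F (erase j w) := hF.comp (measurable_erase j)
    have h2 := lintegral_map (μ := partialLaw ν μ q (stepKernel D P) j)
      (((hκ j true).mul hm1).add ((hκ j false).mul hF)) (measurable_mask j)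
    rw [ih'] at h2
    refine h2.symm.trans ?_
    -- The kernel at M_j = 1 turns the mixture into π_j `P j`, and erasing y_j gives the law `D
    -- j.succ` on M_j = 1 by the matching of the marginal.
    have h3 : ∫⁻ w, stepKernel D P j true w * F (erase j w) ∂(D j.castSucc) =
        ∫⁻ w in starAt 𝒳 𝒴 j, F w ∂(D j.succ) := by
      have h4 := lintegral_withDensity_eq_lintegral_mul (D j.castSucc) (hκ j true) hm1
      rw [hrun.stepKernel_true h0 h1 j, lintegral_smul_measure] at h4
      refine h4.symm.trans ?_
      rw [← lintegral_map hF (measurable_erase j), (hrun.projection j).1.2.2.1,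
        ← lintegral_smul_measure, smul_cond_eq_restrict]
      rw [hrun.measure_starAt h0 h1 j]
      exact h0 j
    have h5 : ∫⁻ w, stepKernel D P j false w * F w ∂(D j.castSucc) =
        ∫⁻ w in (starAt 𝒳 𝒴 j)ᶜ, F w ∂(D j.succ) := by
      have h4 := lintegral_withDensity_eq_lintegral_mul (D j.castSucc) (hκ j false) hF
      rw [hrun.stepKernel_false h0 h1 j] at h4
      exact h4.symm
    have h6 : ∫⁻ w, (stepKernel D P j true w * F (erase j w) + stepKernel D P j false w * F w)
        ∂(D j.castSucc) = ∫⁻ w, F w ∂(D j.succ) := by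
      rw [lintegral_add_left (f := fun w => stepKernel D P j true w * F (erase j w))
        ((hκ j true).mul hm1), h3, h5,
        lintegral_add_compl _ (measurableSet_starAt j)]
    exact h6

end Run

/-! ### Observed-data densities -/

theorem lmarginal_mul_of_invariant {δ : Type*} [DecidableEq δ] {X : δ → Type*}
    [∀ i, MeasurableSpace (X i)] (μ : ∀ i, Measure (X i)) (s : Finset δ)
    {f g : (∀ i, X i) → ℝ≥0∞} (hf : Measurable f)
    (hg : ∀ x z, g (Function.updateFinset x s z) = g x) (x : ∀ i, X i) :
    lmarginal μ s (fun y => f y * g y) x = lmarginal μ s f x * g x := by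
  simp only [lmarginal, hg]
  exact lintegral_mul_const _ (hf.comp measurable_updateFinset)

theorem lmarginal_updateFinset {δ : Type*} [DecidableEq δ] {X : δ → Type*}
    [∀ i, MeasurableSpace (X i)] (μ : ∀ i, Measure (X i)) (s : Finset δ)
    (f : (∀ i, X i) → ℝ≥0∞) (x : ∀ i, X i) (z : ∀ i : s, X i) :
    lmarginal μ s f (Function.updateFinset x s z) = lmarginal μ s f x := by
  refine lmarginal_congr _ _ fun i hi => ?_
  simp [Function.updateFinset, hi]

/-- The marginal operator is self-adjoint. -/
theorem lintegral_mul_lmarginal {δ : Type*} [DecidableEq δ] [Fintype δ] {X : δ → Type*}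
    [∀ i, MeasurableSpace (X i)] (μ : ∀ i, Measure (X i)) [∀ i, SigmaFinite (μ i)] (s : Finset δ)
    {f g : (∀ i, X i) → ℝ≥0∞} (hf : Measurable f) (hg : Measurable g) :
    ∫⁻ x, f x * lmarginal μ s g x ∂(Measure.pi μ) =
      ∫⁻ x, lmarginal μ s f x * g x ∂(Measure.pi μ) := by
  -- A marginal over s is constant in the coordinates of s and factors out, so both sides have the
  -- product of the two marginals as their s-marginal.
  refine lintegral_eq_of_lmarginal_eq s (hf.mul (hg.lmarginal μ)) ((hf.lmarginal μ).mul hg) ?_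
  funext x
  refine (lmarginal_mul_of_invariant μ s hf (lmarginal_updateFinset μ s g) x).trans ?_
  have h := lmarginal_mul_of_invariant μ s hg (lmarginal_updateFinset μ s f) x
  rw [mul_comm, ← h]
  refine congrArg (fun F => lmarginal μ s F x) ?_
  funext y
  exact mul_comm _ _

section ObsDensity

variable {p : ℕ} {𝒳 : Type u} {𝒴 : Fin p → Type v} [MeasurableSpace 𝒳]
  [∀ i, MeasurableSpace (𝒴 i)] (ν : Measure 𝒳) (μ : ∀ i, Measure (𝒴 i))
  [∀ i, SigmaFinite (μ i)]

/-- The set of integrated coordinates varies with m, but m takes finitely many values, so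
measurability is checked for each m. -/
theorem measurable_obsDensity {f : FullData 𝒳 𝒴 → ℝ≥0∞} (hf : Measurable f) :
    Measurable (obsDensity μ f) := by
  have h : ∀ m : Fin p → Bool, Measurable fun z : 𝒳 × (∀ i, 𝒴 i) =>
      obsDensity μ f (z.1, z.2, m) := by
    intro m
    unfold obsDensity lmarginal
    refine Measurable.lintegral_prod_right'
      (ν := Measure.pi fun i : Finset.univ.filter (fun i => m i = true) => μ i)
      (f := fun t : (𝒳 × (∀ i, 𝒴 i)) × (∀ i : Finset.univ.filter (fun i => m i = true), 𝒴 i) =>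
        f (t.1.1, Function.updateFinset t.1.2 _ t.2, m)) ?_
    refine hf.comp ((measurable_fst.comp measurable_fst).prodMk (Measurable.prodMk ?_
      measurable_const))
    refine measurable_pi_lambda _ fun i => ?_
    by_cases hi : i ∈ Finset.univ.filter (fun i => m i = true)
    · simp only [Function.updateFinset, hi, dif_pos]
      exact (measurable_pi_apply _).comp measurable_snd
    · simp only [Function.updateFinset, hi, dif_neg, not_false_eq_true]
      exact (measurable_pi_apply i).comp (measurable_snd.comp measurable_fst)
  have h2 : Measurable fun t : (Fin p → Bool) × 𝒳 × (∀ i, 𝒴 i) =>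
      obsDensity μ f (t.2.1, t.2.2, t.1) :=
    measurable_from_prod_countable_right h
  exact h2.comp ((measurable_snd.comp measurable_snd).prodMk
    (measurable_fst.prodMk (measurable_fst.comp measurable_snd)))

/-- The operator `obsDensity` is self-adjoint. -/
theorem lintegral_mul_obsDensity [SFinite ν] {f g : FullData 𝒳 𝒴 → ℝ≥0∞} (hf : Measurable f)
    (hg : Measurable g) :
    ∫⁻ ω, f ω * obsDensity μ g ω ∂(baseMeasure ν μ) =
      ∫⁻ ω, obsDensity μ f ω * g ω ∂(baseMeasure ν μ) := by
  have hm1 := hf.mul (measurable_obsDensity μ hg)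
  have hm2 := (measurable_obsDensity μ hf).mul hg
  rw [lintegral_baseMeasure ν μ (F := fun ω => f ω * obsDensity μ g ω) hm1,
    lintegral_baseMeasure ν μ (F := fun ω => obsDensity μ f ω * g ω) hm2]
  refine Finset.sum_congr rfl fun m _ => ?_
  have hs : Measurable fun z : 𝒳 × (∀ i, 𝒴 i) => ((z.1, z.2, m) : FullData 𝒳 𝒴) :=
    measurable_fst.prodMk (measurable_snd.prodMk measurable_const)
  rw [lintegral_prod (fun z : 𝒳 × (∀ i, 𝒴 i) => f (z.1, z.2, m) * obsDensity μ g (z.1, z.2, m))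
      (hm1.comp hs).aemeasurable,
    lintegral_prod (fun z : 𝒳 × (∀ i, 𝒴 i) => obsDensity μ f (z.1, z.2, m) * g (z.1, z.2, m))
      (hm2.comp hs).aemeasurable]
  refine lintegral_congr fun x => ?_
  have hx : Measurable fun y : ∀ i, 𝒴 i => ((x, y, m) : FullData 𝒳 𝒴) :=
    measurable_const.prodMk (measurable_id.prodMk measurable_const)
  exact lintegral_mul_lmarginal μ (Finset.univ.filter fun i => m i = true)
    (f := fun y => f (x, y, m)) (g := fun y => g (x, y, m)) (hf.comp hx) (hg.comp hx)

/-- The observed-data density is a function of the observed data. -/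
theorem exists_obsDensity_eq_comp_materialize [∀ i, Nonempty (𝒴 i)]
    {f : FullData 𝒳 𝒴 → ℝ≥0∞} (hf : Measurable f) :
    ∃ Θ : Materialized 𝒳 𝒴 → ℝ≥0∞, Measurable Θ ∧ ∀ ω, obsDensity μ f ω = Θ (materialize ω) := by
  have hs : Measurable fun w : Materialized 𝒳 𝒴 => fun i => (w.2 i).isRight := by
    refine measurable_pi_lambda _ fun i => measurable_to_bool ?_
    have h : (fun w : Materialized 𝒳 𝒴 => (w.2 i).isRight) ⁻¹' {true} = starAt 𝒳 𝒴 i := by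
      ext w
      rcases h : w.2 i with y | y <;> simp [starAt, h]
    rw [h]
    exact measurableSet_starAt i
  -- The placeholders determine m, and the coordinates filled arbitrarily are precisely those that
  -- are integrated out.
  refine ⟨fun w => obsDensity μ f (w.1, yPart w, fun i => (w.2 i).isRight),
    (measurable_obsDensity μ hf).comp (measurable_fst.prodMk (measurable_yPart.prodMk hs)),
    fun ω => ?_⟩
  have h1 : (fun i => ((materialize ω).2 i).isRight) = ω.2.2 := by
    funext i
    cases h : ω.2.2 i <;> simp [materialize, mask, h]
  simp only [h1]
  unfold obsDensity
  refine lmarginal_congr _ _ fun i hi => ?_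
  have h2 : ¬ ω.2.2 i = true := by simpa using hi
  simp [yPart, materialize, mask, h2]

/-- By self-adjointness, the integral of the observed-data density over s equals the integral of the
full density against the marginalized indicator of s. The latter is a function of the observed data,
so only the observed law enters. -/
theorem obsDensity_ae_eq [SigmaFinite ν] [∀ i, Nonempty (𝒴 i)] {f g : FullData 𝒳 𝒴 → ℝ≥0∞}
    (hf : Measurable f) (hg : Measurable g)
    (h : ObservationallyEquivalent (law ν μ f) (law ν μ g)) :
    ∀ᵐ ω ∂(baseMeasure ν μ), obsDensity μ f ω = obsDensity μ g ω := by
  have hsf : SigmaFinite (baseMeasure ν μ) := by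
    unfold baseMeasure
    infer_instance
  refine ae_eq_of_forall_setLIntegral_eq_of_sigmaFinite (measurable_obsDensity μ hf)
    (measurable_obsDensity μ hg) fun s hs _ => ?_
  have h1 : Measurable (s.indicator (1 : FullData 𝒳 𝒴 → ℝ≥0∞)) := measurable_one.indicator hs
  obtain ⟨Θ, hΘ, hΘeq⟩ := exists_obsDensity_eq_comp_materialize μ h1
  have key : ∀ f : FullData 𝒳 𝒴 → ℝ≥0∞, Measurable f →
      ∫⁻ ω in s, obsDensity μ f ω ∂(baseMeasure ν μ) =
        ∫⁻ w, Θ w ∂((law ν μ f).map materialize) := by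
    intro f hf
    have hmat : Measurable (materialize : FullData 𝒳 𝒴 → Materialized 𝒳 𝒴) := measurable_mask p
    rw [lintegral_map hΘ hmat, law,
      lintegral_withDensity_eq_lintegral_mul (g := fun ω => Θ (materialize ω)) _ hf
        (hΘ.comp hmat), ← lintegral_indicator hs]
    have h2 := lintegral_mul_obsDensity ν μ h1 hf
    refine Eq.trans (lintegral_congr fun ω => ?_) (h2.trans (lintegral_congr fun ω => ?_))
    · by_cases hω : ω ∈ s <;> simp [hω]
    · rw [Pi.mul_apply, hΘeq, mul_comm]
  rw [key f hf, key g hg]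
  exact congrArg (fun R : Measure (Materialized 𝒳 𝒴) => lintegral R Θ) h

end ObsDensity

/-! ### Conditional probabilities of missingness -/

section CondExp

variable {p : ℕ} {𝒳 : Type u} {𝒴 : Fin p → Type v} [MeasurableSpace 𝒳]
  [∀ i, MeasurableSpace (𝒴 i)] (ν : Measure 𝒳) (μ : ∀ i, Measure (𝒴 i))
  [∀ i, SigmaFinite (μ i)]
  {q : 𝒳 × (∀ i, 𝒴 i) → ℝ≥0∞} {κ : Fin p → Bool → Materialized 𝒳 𝒴 → ℝ≥0∞}

/-- Under the full law, the conditional probability of `M_j = 1` given any part of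
`(x, y, m_{<j})` that determines `(x, y^*_{<j}, y_{≥j})` is `κ_j`. -/
theorem condExp_missInd_ae_eq (hq : Measurable q) (hκ : ∀ j b, Measurable (κ j b))
    (hsum : ∀ j : Fin p, ∀ᵐ w ∂(partialLaw ν μ q κ j).map (mask j), κ j true w + κ j false w = 1)
    [IsFiniteMeasure (partialLaw ν μ q κ p)] (j : Fin p)
    (hle : ∀ᵐ ω ∂(partialLaw ν μ q κ p), κ j true (mask j ω) ≤ 1)
    {Z : Type*} [MeasurableSpace Z] (T : FullData 𝒳 𝒴 → Z) (hT : Measurable T)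
    (hTinv : ∀ i : Fin p, j ≤ i → ∀ b ω, T (setMiss i b ω) = T ω)
    (φ : Z → Materialized 𝒳 𝒴) (hφ : Measurable φ) (hmask : ∀ ω, mask j ω = φ (T ω)) :
    condExp (MeasurableSpace.comap T inferInstance) (partialLaw ν μ q κ p) (missInd 𝒳 𝒴 j)
      =ᵐ[partialLaw ν μ q κ p] fun ω => (κ j true (mask j ω)).toReal := by
  set G := partialLaw ν μ q κ p
  have hkm : Measurable fun ω : FullData 𝒳 𝒴 => κ j true (mask j ω) :=
    (hκ j true).comp (measurable_mask _)
  have hkb : Integrable (fun ω => (κ j true (mask j ω)).toReal) G := by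
    refine (integrable_const (1 : ℝ)).mono' hkm.ennreal_toReal.aestronglyMeasurable ?_
    filter_upwards [hle] with ω hω
    rw [Real.norm_of_nonneg ENNReal.toReal_nonneg]
    exact ENNReal.toReal_le_of_le_ofReal zero_le_one (by simpa using hω)
  symm
  refine ae_eq_condExp_of_forall_setIntegral_eq hT.comap_le
    ((integrable_const (1 : ℝ)).indicator (measurableSet_missing j))
    (fun s _ _ => hkb.integrableOn) ?_ ?_
  · rintro _ ⟨A, hA, rfl⟩ -
    have hs : MeasurableSet (T ⁻¹' A) := hT hA
    -- Events determined by `T` do not involve m_j or later indicators, so they are admissible test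
    -- functions for the kernel identity.
    have h1 := setLIntegral_partialLaw_missing ν μ hq hκ hsum j
      (F := (T ⁻¹' A).indicator 1) (measurable_one.indicator hs) (fun i hi b ω => by
        have h : setMiss i b ω ∈ T ⁻¹' A ↔ ω ∈ T ⁻¹' A := by
          rw [Set.mem_preimage, hTinv i hi, Set.mem_preimage]
        by_cases hω : ω ∈ T ⁻¹' A
        · rw [Set.indicator_of_mem hω, Set.indicator_of_mem (h.2 hω)]
          rfl
        · rw [Set.indicator_of_notMem hω, Set.indicator_of_notMem (mt h.1 hω)])
    have h2 : ∫⁻ ω in T ⁻¹' A, κ j true (mask j ω) ∂G = G (missing 𝒳 𝒴 j ∩ T ⁻¹' A) := by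
      have h3 : ∫⁻ ω, κ j true (mask j ω) * (T ⁻¹' A).indicator 1 ω ∂G =
          ∫⁻ ω in T ⁻¹' A, κ j true (mask j ω) ∂G := by
        rw [← lintegral_indicator hs]
        refine lintegral_congr fun ω => ?_
        by_cases hω : ω ∈ T ⁻¹' A <;> simp [hω]
      rw [← h3, ← h1, lintegral_indicator_one hs, Measure.restrict_apply hs, Set.inter_comm]
    rw [integral_toReal hkm.aemeasurable, h2]
    · rw [missInd, integral_indicator (measurableSet_missing j), setIntegral_const,
        Measure.real, Measure.restrict_apply (measurableSet_missing j), smul_eq_mul, mul_one]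
    · refine ae_restrict_of_ae ?_
      filter_upwards [hle] with ω hω using hω.trans_lt ENNReal.one_lt_top
  · have h : (fun ω => (κ j true (mask j ω)).toReal) = fun ω => (κ j true (φ (T ω))).toReal := by
      funext ω
      rw [hmask]
    rw [h]
    refine Measurable.aestronglyMeasurable ?_
    exact ((hκ j true).comp hφ).ennreal_toReal.comp (comap_measurable T)

/-- With this factorization the same kernel computes the conditional probability given the whole
history (x, y, m_{<j}). -/
theorem exists_measurable_mask_eq_history (j : Fin p) :
    ∃ φ : 𝒳 × (∀ i, 𝒴 i) × ({i : Fin p // i < j} → Bool) → Materialized 𝒳 𝒴, Measurable φ ∧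
      ∀ ω : FullData 𝒳 𝒴, mask j ω =
        φ (ω.1, ω.2.1, fun i : {i : Fin p // i < j} => ω.2.2 i) := by
  classical
  refine ⟨fun t => (t.1, fun i => if h : i < j then
    (if t.2.2 ⟨i, h⟩ = true then Sum.inr () else Sum.inl (t.2.1 i)) else Sum.inl (t.2.1 i)),
    ?_, fun ω => ?_⟩
  · refine measurable_fst.prodMk (measurable_pi_lambda _ fun i => ?_)
    have hy : Measurable fun t : 𝒳 × (∀ i, 𝒴 i) × ({i : Fin p // i < j} → Bool) =>
        (Sum.inl (t.2.1 i) : 𝒴 i ⊕ Unit) :=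
      measurable_inl.comp ((measurable_pi_apply i).comp (measurable_fst.comp measurable_snd))
    by_cases h : i < j
    · simp only [h, dif_pos]
      refine Measurable.ite ?_ measurable_const hy
      exact measurableSet_eq_fun ((measurable_pi_apply _).comp
        (measurable_snd.comp measurable_snd)) measurable_const
    · simp only [h, dif_neg, not_false_eq_true]
      exact hy
  · refine Prod.ext rfl (funext fun i => ?_)
    by_cases h : i < j
    · simp [mask, h]
    · simp [mask, h]

end CondExp

/-! ### Consequences and transport of `L¹`-closure -/

section Closure

/-- An element of the `L¹`-closure of a space is an almost sure limit of elements of the space. -/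
theorem InL1Closure.exists_seq_tendsto_ae {Ω : Type*} [MeasurableSpace Ω] {P : Measure Ω}
    {V : Submodule ℝ (Ω → ℝ)} {φ : Ω → ℝ} (h : InL1Closure P V φ) :
    ∃ v : ℕ → Ω → ℝ, (∀ n, v n ∈ V) ∧
      ∀ᵐ w ∂P, Filter.Tendsto (fun n => v n w) Filter.atTop (nhds (φ w)) := by
  choose v hvV hvi hv using fun n : ℕ => h.2 (1 / ((n : ℝ) + 1)) Nat.one_div_pos_of_nat
  have h1 : Filter.Tendsto (fun n => eLpNorm (v n - φ) 1 P) Filter.atTop (nhds 0) := by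
    have h2 : Filter.Tendsto (fun n : ℕ => ENNReal.ofReal (1 / ((n : ℝ) + 1))) Filter.atTop
        (nhds 0) := by
      rw [← ENNReal.ofReal_zero]
      exact ENNReal.tendsto_ofReal tendsto_one_div_add_atTop_nhds_zero_nat
    refine tendsto_of_tendsto_of_tendsto_of_le_of_le tendsto_const_nhds h2
      (fun _ => zero_le) fun n => ?_
    rw [eLpNorm_one_eq_lintegral_enorm, ← ofReal_integral_norm_eq_lintegral_enorm
      ((hvi n).sub h.1)]
    refine ENNReal.ofReal_le_ofReal ((le_of_eq ?_).trans (hv n).le)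
    refine integral_congr_ae (ae_of_all _ fun w => ?_)
    change ‖v n w - φ w‖ = |φ w - v n w|
    rw [Real.norm_eq_abs, abs_sub_comm]
  obtain ⟨ns, -, hns⟩ := (tendstoInMeasure_of_tendsto_eLpNorm one_ne_zero
    (fun n => (hvi n).aestronglyMeasurable) h.1.aestronglyMeasurable h1).exists_seq_tendsto_ae
  exact ⟨fun n => v (ns n), fun n => hvV _, hns⟩

/-- Composition with a measure-preserving map is isometric on L¹. It transports the closure from
masked to full data and, for the identity map, allows a change of representative. -/
theorem InL1Closure.comp {Ω Ω' : Type*} [MeasurableSpace Ω] [MeasurableSpace Ω']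
    {P : Measure Ω} {P' : Measure Ω'} {T : Ω' → Ω} (hT : Measurable T) (hP : P'.map T = P)
    {V : Submodule ℝ (Ω → ℝ)} {V' : Submodule ℝ (Ω' → ℝ)} {φ : Ω → ℝ} {φ' : Ω' → ℝ}
    (hV : ∀ v ∈ V, v ∘ T ∈ V') (hφ : φ' =ᵐ[P'] φ ∘ T) (h : InL1Closure P V φ) :
    InL1Closure P' V' φ' := by
  subst hP
  refine ⟨(h.1.comp_measurable hT).congr hφ.symm, fun ε hε => ?_⟩
  obtain ⟨v, hvV, hvi, hv⟩ := h.2 ε hε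
  refine ⟨v ∘ T, hV v hvV, hvi.comp_measurable hT, lt_of_eq_of_lt ?_ hv⟩
  rw [integral_map (f := fun w => |φ w - v w|) hT.aemeasurable
    (h.1.sub hvi).abs.aestronglyMeasurable]
  refine integral_congr_ae ?_
  filter_upwards [hφ] with w hw
  rw [hw]
  rfl

end Closure

/-! ### Perturbations within the constraint set -/

section Projection

variable {p : ℕ} {𝒳 : Type u} {𝒴 : Fin p → Type v} [MeasurableSpace 𝒳]
  [∀ i, MeasurableSpace (𝒴 i)] [∀ i, Nonempty (𝒴 i)]

/-- The linear span of `L_1(x, y^*_{<j}, y_{>j}) ∪ U_{≥j}`, the elements being seen as functions of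
`(x, y^*_{<j}, y_{≥j})`. -/
noncomputable def stepSpan (U : Set ((∀ i, 𝒴 i) → ℝ)) (Pj : Measure (Materialized 𝒳 𝒴))
    (j : Fin p) : Submodule ℝ (Materialized 𝒳 𝒴 → ℝ) :=
  Submodule.span ℝ
    ({φ | ∃ α : Materialized 𝒳 𝒴 → ℝ, Integrable α (Pj.map (erase j)) ∧
        φ = fun w => α (erase j w)} ∪
      {φ | ∃ u ∈ auxFrom U j, φ = fun w => u (yPart w)})

/-- Only the additive shape is retained, without integrability: this is the property that passes to
pointwise limits. -/
theorem exists_add_of_mem_stepSpan {U : Set ((∀ i, 𝒴 i) → ℝ)} {Pj : Measure (Materialized 𝒳 𝒴)}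
    {j : Fin p} {v : Materialized 𝒳 𝒴 → ℝ} (hv : v ∈ stepSpan U Pj j) :
    ∃ (α : Materialized 𝒳 𝒴 → ℝ) (β : (∀ i, 𝒴 i) → ℝ), DependsOn β {i | j ≤ i} ∧
      ∀ w, v w = α (erase j w) + β (yPart w) := by
  induction hv using Submodule.span_induction with
  | mem v hv =>
    rcases hv with ⟨α, -, rfl⟩ | ⟨u, hu, rfl⟩
    · exact ⟨α, fun _ => 0, fun _ _ _ => rfl, fun w => (add_zero _).symm⟩
    · exact ⟨fun _ => 0, u, hu.2, fun w => (zero_add _).symm⟩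
  | zero => exact ⟨fun _ => 0, fun _ => 0, fun _ _ _ => rfl, fun w => (add_zero _).symm⟩
  | add v v' _ _ h h' =>
    obtain ⟨α, β, hβ, hv⟩ := h
    obtain ⟨α', β', hβ', hv'⟩ := h'
    refine ⟨α + α', β + β', fun y y' hy => ?_, fun w => ?_⟩
    · rw [Pi.add_apply, Pi.add_apply, hβ hy, hβ' hy]
    · simp only [Pi.add_apply, hv, hv']
      ring
  | smul c v _ h =>
    obtain ⟨α, β, hβ, hv⟩ := h
    refine ⟨c • α, c • β, fun y y' hy => ?_, fun w => ?_⟩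
    · rw [Pi.smul_apply, Pi.smul_apply, hβ hy]
    · simp only [Pi.smul_apply, hv, smul_add]

/-- Bounded perturbations of a matching distribution that are orthogonal to the constraints are
matching. -/
theorem withDensity_mem_matching {U : Set ((∀ i, 𝒴 i) → ℝ)} {e : ((∀ i, 𝒴 i) → ℝ) → ℝ}
    {j : Fin p} {R Pj : Measure (Materialized 𝒳 𝒴)} (hP : Pj ∈ matching U e j R)
    {k : Materialized 𝒳 𝒴 → ℝ} (hkm : Measurable k) (hk : ∀ w, |k w| ≤ 1)
    (hkV : ∀ v ∈ stepSpan U Pj j, ∫ w, k w * v w ∂Pj = 0) :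
    Pj.withDensity (fun w => ENNReal.ofReal (1 + k w)) ∈ matching U e j R := by
  obtain ⟨hprob, hstar, hmap, hu⟩ := hP
  have hk0 : ∀ w, 0 ≤ 1 + k w := fun w => by linarith [(abs_le.1 (hk w)).1]
  have hki : Integrable k Pj := (integrable_const (1 : ℝ)).mono' hkm.aestronglyMeasurable
    (ae_of_all _ hk)
  have h1k : Measurable fun w => ENNReal.ofReal (1 + k w) :=
    (measurable_const.add hkm).ennreal_ofReal
  have hmapk : (Pj.withDensity fun w => ENNReal.ofReal (1 + k w)).map (erase j) =
      Pj.map (erase j) := by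
    refine Measure.ext fun s hs => ?_
    have hs' : MeasurableSet (erase j ⁻¹' s) := measurable_erase j hs
    -- Indicators of events of the erased data belong to the span, so `k` integrates to zero over
    -- each of them and the marginal is unchanged; total mass is the case of the whole space.
    have h1 : ∫ w in erase j ⁻¹' s, k w ∂Pj = 0 := by
      rw [← hkV (fun w => s.indicator 1 (erase j w)) (Submodule.subset_span (Or.inl
        ⟨s.indicator 1, ?_, rfl⟩)), ← integral_indicator hs']
      · refine integral_congr_ae (ae_of_all _ fun w => ?_)
        by_cases hw : erase j w ∈ s <;> simp [hw]
      · have := Measure.isProbabilityMeasure_map (μ := Pj) (measurable_erase j).aemeasurable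
        exact (integrable_const (1 : ℝ)).indicator hs
    rw [Measure.map_apply (measurable_erase j) hs, Measure.map_apply (measurable_erase j) hs,
      withDensity_apply _ hs', ← ofReal_integral_eq_lintegral_ofReal
        (f := fun w => 1 + k w) ((integrable_const _).add hki).integrableOn (ae_of_all _ hk0),
      integral_add (integrable_const _).integrableOn hki.integrableOn, h1, add_zero,
      setIntegral_const, smul_eq_mul, mul_one, ofReal_measureReal]
  refine ⟨⟨?_⟩, withDensity_absolutelyContinuous _ _ hstar, hmapk.trans hmap, fun u hu' => ?_⟩
  · have h := congrArg (fun R => R Set.univ) hmapk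
    simpa [Measure.map_apply (measurable_erase j) MeasurableSet.univ] using h
  · obtain ⟨hui, hue⟩ := hu u hu'
    have h1 : ∫ w, k w * u (yPart w) ∂Pj = 0 :=
      hkV _ (Submodule.subset_span (Or.inr ⟨u, hu', rfl⟩))
    have h2 : Integrable (fun w => k w * u (yPart w)) Pj :=
      hui.bdd_mul hkm.aestronglyMeasurable (ae_of_all _ hk)
    have h3 : ∀ w, (ENNReal.ofReal (1 + k w)).toReal • u (yPart w) =
        u (yPart w) + k w * u (yPart w) := fun w => by
      rw [ENNReal.toReal_ofReal (hk0 w), smul_eq_mul]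
      ring
    refine ⟨?_, ?_⟩
    · rw [integrable_withDensity_iff_integrable_smul' h1k (ae_of_all _ fun w =>
        ENNReal.ofReal_lt_top)]
      simp_rw [h3]
      exact hui.add h2
    · rw [integral_withDensity_eq_integral_toReal_smul h1k (ae_of_all _ fun w =>
        ENNReal.ofReal_lt_top)]
      simp_rw [h3]
      rw [integral_add hui h2, h1, add_zero, hue]

theorem integrable_of_mem_stepSpan {U : Set ((∀ i, 𝒴 i) → ℝ)} {e : ((∀ i, 𝒴 i) → ℝ) → ℝ}
    {j : Fin p} {R Pj : Measure (Materialized 𝒳 𝒴)} (hP : Pj ∈ matching U e j R)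
    {v : Materialized 𝒳 𝒴 → ℝ} (hv : v ∈ stepSpan U Pj j) : Integrable v Pj := by
  induction hv using Submodule.span_induction with
  | mem v hv =>
    rcases hv with ⟨α, hα, rfl⟩ | ⟨u, hu, rfl⟩
    · exact hα.comp_measurable (measurable_erase j)
    · exact (hP.2.2.2 u hu).1
  | zero => exact integrable_zero _ _ _
  | add v v' _ _ h h' => exact h.add h'
  | smul c v _ h => exact h.smul c

end Projection

/-! ### Properties of the output -/

section Output

variable {p : ℕ} {𝒳 : Type u} {𝒴 : Fin p → Type v} [MeasurableSpace 𝒳]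
  [∀ i, MeasurableSpace (𝒴 i)] [∀ i, Nonempty (𝒴 i)] {lam : ℝ → ℝ}
  {U : Set ((∀ i, 𝒴 i) → ℝ)} {obs : Measure (Materialized 𝒳 𝒴)} [IsProbabilityMeasure obs]
  {e : ((∀ i, 𝒴 i) → ℝ) → ℝ} {D : Fin (p + 1) → Measure (Materialized 𝒳 𝒴)}
  {P : Fin p → Measure (Materialized 𝒳 𝒴)}

/-- The link of the conditional probability found in a step, as a function of the density ratio, is
in the closure of the span of the constraints. -/
theorem IsRun.inL1Closure_link (hrun : IsRun lam U obs e D P)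
    (h0 : ∀ j, obs (starAt 𝒳 𝒴 j) ≠ 0) (h1 : ∀ j, obs (starAt 𝒳 𝒴 j) ≠ 1)
    (hlam : RegularLink lam) (j : Fin p)
    (hint : ∀ z > 0, IntervalIntegrable
      (fun v => lam (v / (odds (obs.real (starAt 𝒳 𝒴 j)) + v))) volume 0 z)
    (hgrowth : GrowthCondition (linkDiv lam (odds (obs.real (starAt 𝒳 𝒴 j))))) :
    InL1Closure (P j) (stepSpan U (P j) j)
      (fun w => lam (stepKernel D P j true w).toReal) := by
  have := (hrun.invariants h0 h1 j.succ).1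
  have := hrun.isProbabilityMeasure_projection j
  obtain ⟨-, -, hc0⟩ := hrun.mixture_restrict h0 h1 j
  have := cond_isProbabilityMeasure hc0
  have hreal : (D j.succ).real (starAt 𝒳 𝒴 j) = obs.real (starAt 𝒳 𝒴 j) :=
    congrArg ENNReal.toReal (hrun.measure_starAt h0 h1 j)
  have hpos : 0 < obs.real (starAt 𝒳 𝒴 j) :=
    ENNReal.toReal_pos (h0 j) (measure_ne_top _ _)
  have hlt : obs.real (starAt 𝒳 𝒴 j) < 1 := by
    refine lt_of_le_of_ne measureReal_le_one fun h => h1 j ?_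
    rw [← ENNReal.toReal_eq_one_iff]
    exact h
  have hP := hrun.projection j
  have hk := hrun.toReal_stepKernel_true h0 h1 j
  rw [hreal] at hP hk
  have hcl := hP.inL1Closure_link hlam (odds_pos hpos hlt) hint hgrowth (stepSpan U (P j) j)
    (fun v hv => integrable_of_mem_stepSpan hP.1 hv)
    (fun k hkm hk hkV => withDensity_mem_matching hP.1 hkm hk hkV)
  -- The ratio r / (c + r) is replaced by the kernel. They agree almost surely under the mixture,
  -- which dominates `P j` because π_j > 0.
  refine hcl.comp (T := id) measurable_id Measure.map_id (fun v hv => hv) ?_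
  have hac : P j ≪ D j.castSucc := by
    refine (Measure.absolutelyContinuous_smul (c := D j.succ (starAt 𝒳 𝒴 j)) ?_).trans ?_
    · rw [hrun.measure_starAt h0 h1 j]
      exact h0 j
    · rw [← hrun.stepKernel_true h0 h1 j]
      exact withDensity_absolutelyContinuous _ _
  filter_upwards [hac.ae_le hk] with w hw
  simp only [Function.comp_apply, id_eq]
  rw [hw]

variable (ν : Measure 𝒳) (μ : ∀ i, Measure (𝒴 i)) [∀ i, SigmaFinite (μ i)]
  {q : 𝒳 × (∀ i, 𝒴 i) → ℝ≥0∞}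

theorem IsRun.kernel_sum_partialLaw (hrun : IsRun lam U obs e D P)
    (h0 : ∀ j, obs (starAt 𝒳 𝒴 j) ≠ 0) (h1 : ∀ j, obs (starAt 𝒳 𝒴 j) ≠ 1)
    (hq : Measurable q) (hqD : ((ν.prod (Measure.pi μ)).withDensity q).map reveal = D 0)
    (j : Fin p) :
    ∀ᵐ w ∂(partialLaw ν μ q (stepKernel D P) j).map (mask j),
      stepKernel D P j true w + stepKernel D P j false w = 1 := by
  have h := hrun.map_mask_partialLaw ν μ h0 h1 hq hqD j.castSucc
  rw [Fin.val_castSucc] at h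
  rw [h]
  exact hrun.stepKernel_sum h0 h1 j

/-- The output has the laws of the construction as marginals. -/
theorem IsRun.map_mask_output (hrun : IsRun lam U obs e D P)
    (h0 : ∀ j, obs (starAt 𝒳 𝒴 j) ≠ 0) (h1 : ∀ j, obs (starAt 𝒳 𝒴 j) ≠ 1)
    (hq : Measurable q) (hqD : ((ν.prod (Measure.pi μ)).withDensity q).map reveal = D 0)
    (k : Fin (p + 1)) :
    (partialLaw ν μ q (stepKernel D P) p).map (mask k) = D k := by
  rw [← hrun.map_mask_partialLaw ν μ h0 h1 hq hqD k]
  refine Measure.ext_of_lintegral _ fun F hF => ?_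
  rw [lintegral_map hF (measurable_mask _), lintegral_map hF (measurable_mask _)]
  exact lintegral_partialLaw_of_invariant ν μ hq (fun j b => measurable_stepKernel j b)
    (hrun.kernel_sum_partialLaw ν μ h0 h1 hq hqD) (F := fun ω => F (mask k ω))
    (hF.comp (measurable_mask _))
    (fun j hj b ω => by rw [mask_setMiss j b hj]) (Nat.lt_succ_iff.1 k.2) le_rfl

theorem IsRun.isProbabilityMeasure_output (hrun : IsRun lam U obs e D P)
    (h0 : ∀ j, obs (starAt 𝒳 𝒴 j) ≠ 0) (h1 : ∀ j, obs (starAt 𝒳 𝒴 j) ≠ 1)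
    (hq : Measurable q) (hqD : ((ν.prod (Measure.pi μ)).withDensity q).map reveal = D 0) :
    IsProbabilityMeasure (partialLaw ν μ q (stepKernel D P) p) := by
  have := (hrun.invariants h0 h1 0).1
  have h := congrArg (fun R => R Set.univ) (hrun.map_mask_output ν μ h0 h1 hq hqD 0)
  refine ⟨?_⟩
  simpa [Measure.map_apply (measurable_mask _) MeasurableSet.univ] using h

/-- Given `M_j = 1`, the law of `(x, y^*_{<j}, y_{≥j})` under the output is the projection. -/
theorem IsRun.map_mask_cond_missing (hrun : IsRun lam U obs e D P)
    (h0 : ∀ j, obs (starAt 𝒳 𝒴 j) ≠ 0) (h1 : ∀ j, obs (starAt 𝒳 𝒴 j) ≠ 1)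
    (hq : Measurable q) (hqD : ((ν.prod (Measure.pi μ)).withDensity q).map reveal = D 0)
    (j : Fin p) :
    (cond (partialLaw ν μ q (stepKernel D P) p) (missing 𝒳 𝒴 j)).map (mask j) = P j := by
  have := hrun.isProbabilityMeasure_output ν μ h0 h1 hq hqD
  have := hrun.isProbabilityMeasure_projection j
  have := (hrun.invariants h0 h1 j.succ).1
  have hκ : ∀ j b, Measurable (stepKernel D P j b) := fun j b => measurable_stepKernel j b
  have ha0 : D j.succ (starAt 𝒳 𝒴 j) ≠ 0 := by rw [hrun.measure_starAt h0 h1 j]; exact h0 j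
  -- Restricting the output to M_j = 1 weights the masked law `D j.castSucc` by the kernel, which
  -- gives π_j `P j`; normalization removes π_j.
  have hres : ((partialLaw ν μ q (stepKernel D P) p).restrict (missing 𝒳 𝒴 j)).map (mask j) =
      D j.succ (starAt 𝒳 𝒴 j) • P j := by
    refine Measure.ext_of_lintegral _ fun F hF => ?_
    rw [lintegral_map hF (measurable_mask _),
      setLIntegral_partialLaw_missing ν μ hq hκ (hrun.kernel_sum_partialLaw ν μ h0 h1 hq hqD) j
        (F := fun ω => F (mask j ω)) (hF.comp (measurable_mask _))
        (fun i hi b ω => by rw [mask_setMiss i b hi]),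
      ← hrun.stepKernel_true h0 h1 j,
      lintegral_withDensity_eq_lintegral_mul _ (hκ j true) hF,
      ← hrun.map_mask_output ν μ h0 h1 hq hqD j.castSucc,
      lintegral_map ((hκ j true).mul hF) (measurable_mask _)]
    rfl
  have hmeas : partialLaw ν μ q (stepKernel D P) p (missing 𝒳 𝒴 j) =
      D j.succ (starAt 𝒳 𝒴 j) := by
    have h := congrArg (fun R => R Set.univ) hres
    simpa [Measure.map_apply (measurable_mask _) MeasurableSet.univ] using h
  rw [ProbabilityTheory.cond, Measure.map_smul, hres, hmeas, smul_smul,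
    ENNReal.inv_mul_cancel ha0 (measure_ne_top _ _), one_smul]

theorem IsRun.kernel_le_one_output (hrun : IsRun lam U obs e D P)
    (h0 : ∀ j, obs (starAt 𝒳 𝒴 j) ≠ 0) (h1 : ∀ j, obs (starAt 𝒳 𝒴 j) ≠ 1)
    (hq : Measurable q) (hqD : ((ν.prod (Measure.pi μ)).withDensity q).map reveal = D 0)
    (j : Fin p) :
    ∀ᵐ ω ∂(partialLaw ν μ q (stepKernel D P) p), stepKernel D P j true (mask j ω) ≤ 1 := by
  have h := hrun.stepKernel_sum h0 h1 j
  rw [← hrun.map_mask_output ν μ h0 h1 hq hqD j.castSucc] at h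
  filter_upwards [ae_of_ae_map (measurable_mask _).aemeasurable h] with ω hω
  rw [Fin.val_castSucc] at hω
  rw [← hω]
  exact le_self_add

theorem IsRun.missProb_ae_eq (hrun : IsRun lam U obs e D P)
    (h0 : ∀ j, obs (starAt 𝒳 𝒴 j) ≠ 0) (h1 : ∀ j, obs (starAt 𝒳 𝒴 j) ≠ 1)
    (hq : Measurable q) (hqD : ((ν.prod (Measure.pi μ)).withDensity q).map reveal = D 0)
    (j : Fin p) :
    missProb (partialLaw ν μ q (stepKernel D P) p) j
      =ᵐ[partialLaw ν μ q (stepKernel D P) p]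
        fun ω => (stepKernel D P j true (mask j ω)).toReal := by
  have := hrun.isProbabilityMeasure_output ν μ h0 h1 hq hqD
  exact condExp_missInd_ae_eq ν μ hq (fun j b => measurable_stepKernel j b)
    (hrun.kernel_sum_partialLaw ν μ h0 h1 hq hqD) j
    (hrun.kernel_le_one_output ν μ h0 h1 hq hqD j) (mask j) (measurable_mask _)
    (fun i hi b ω => mask_setMiss i b hi ω) id measurable_id fun ω => rfl

theorem IsRun.missProbHistory_ae_eq (hrun : IsRun lam U obs e D P)
    (h0 : ∀ j, obs (starAt 𝒳 𝒴 j) ≠ 0) (h1 : ∀ j, obs (starAt 𝒳 𝒴 j) ≠ 1)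
    (hq : Measurable q) (hqD : ((ν.prod (Measure.pi μ)).withDensity q).map reveal = D 0)
    (j : Fin p) :
    missProbHistory (partialLaw ν μ q (stepKernel D P) p) j
      =ᵐ[partialLaw ν μ q (stepKernel D P) p]
        fun ω => (stepKernel D P j true (mask j ω)).toReal := by
  have := hrun.isProbabilityMeasure_output ν μ h0 h1 hq hqD
  obtain ⟨φ, hφ, hφm⟩ := exists_measurable_mask_eq_history (𝒳 := 𝒳) (𝒴 := 𝒴) j
  refine condExp_missInd_ae_eq ν μ hq (fun j b => measurable_stepKernel j b)
    (hrun.kernel_sum_partialLaw ν μ h0 h1 hq hqD) j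
    (hrun.kernel_le_one_output ν μ h0 h1 hq hqD j)
    (fun ω : FullData 𝒳 𝒴 => (ω.1, ω.2.1, fun i : {i : Fin p // i < j} => ω.2.2 i)) ?_ ?_ φ hφ hφm
  · exact measurable_fst.prodMk ((measurable_fst.comp measurable_snd).prodMk
      (measurable_pi_lambda _ fun i => (measurable_pi_apply _).comp
        (measurable_snd.comp measurable_snd)))
  · intro i hi b ω
    refine Prod.ext rfl (Prod.ext rfl (funext fun i' => ?_))
    have hne : (i' : Fin p) ≠ i := (lt_of_lt_of_le i'.2 hi).ne
    simp [setMiss, Function.update_of_ne hne]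

/-- Both conditional probabilities are the step kernel. Its link is additive as a limit of additive
functions, and the kernel is below 1 because the odds are positive. -/
theorem IsRun.sequentiallyAdditive (hrun : IsRun lam U obs e D P)
    (h0 : ∀ j, obs (starAt 𝒳 𝒴 j) ≠ 0) (h1 : ∀ j, obs (starAt 𝒳 𝒴 j) ≠ 1)
    (hq : Measurable q) (hqD : ((ν.prod (Measure.pi μ)).withDensity q).map reveal = D 0)
    (hcl : ∀ j, InL1Closure (P j) (stepSpan U (P j) j)
      (fun w => lam (stepKernel D P j true w).toReal)) :
    SequentiallyAdditive lam (partialLaw ν μ q (stepKernel D P) p) := by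
  intro j
  have hmp := hrun.missProb_ae_eq ν μ h0 h1 hq hqD j
  refine ⟨(hrun.missProbHistory_ae_eq ν μ h0 h1 hq hqD j).trans hmp.symm, ?_⟩
  obtain ⟨v, hv, hlim⟩ := (hcl j).exists_seq_tendsto_ae
  choose α β hβ hαβ using fun n => exists_add_of_mem_stepSpan (hv n)
  simp_rw [hαβ] at hlim
  obtain ⟨L, hL⟩ := exists_add_of_tendsto {w | Filter.Tendsto
    (fun n => α n (erase j w) + β n (yPart w)) Filter.atTop
      (nhds (lam (stepKernel D P j true w).toReal))}
    (erase j) yPart α β (fun w => lam (stepKernel D P j true w).toReal) fun w hw => hw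
  have hβL : DependsOn (fun y => L fun n => β n y) {i | j ≤ i} := by
    intro y y' hy
    simp only
    congr 1
    funext n
    exact hβ n hy
  refine ⟨fun w => L fun n => α n w, fun y => L fun n => β n y, hβL, ?_⟩
  -- Additivity is known only `P j`-almost surely. As π_j `P j` has the kernel as its density over
  -- the mixture, this means almost surely under the mixture where the kernel is nonzero.
  have hpos : ∀ᵐ w ∂(D j.castSucc), stepKernel D P j true w ≠ 0 →
      lam (stepKernel D P j true w).toReal =
        (L fun n => α n (erase j w)) + L fun n => β n (yPart w) := by
    rw [← ae_withDensity_iff (measurable_stepKernel j true), hrun.stepKernel_true h0 h1 j]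
    refine Measure.ae_smul_measure ?_ _
    filter_upwards [hlim] with w hw
    exact hL w hw
  have hlt := hrun.toReal_stepKernel_true h0 h1 j
  rw [← hrun.map_mask_output ν μ h0 h1 hq hqD j.castSucc] at hpos hlt
  have := (hrun.invariants h0 h1 j.succ).1
  have hodds : 0 < odds ((D j.succ).real (starAt 𝒳 𝒴 j)) := by
    have hs := hrun.measure_starAt h0 h1 j
    refine odds_pos (ENNReal.toReal_pos (by rw [hs]; exact h0 j) (measure_ne_top _ _))
      (lt_of_le_of_ne measureReal_le_one fun h => h1 j ?_)
    rw [← hs, ← ENNReal.toReal_eq_one_iff]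
    exact h
  filter_upwards [hmp, ae_of_ae_map (measurable_mask _).aemeasurable hpos,
    ae_of_ae_map (measurable_mask _).aemeasurable hlt] with ω h2 h3 h4
  rw [Fin.val_castSucc] at h3 h4
  rw [h2]
  refine ⟨?_, fun h5 => ?_⟩
  · rw [h4, div_lt_one (add_pos_of_pos_of_nonneg hodds ENNReal.toReal_nonneg)]
    linarith
  · rw [h3 (ENNReal.toReal_pos_iff.1 h5).1.ne']
    congr 1
    exact yPart_mask hβL ω

theorem IsRun.inL1Closure_missProb (hrun : IsRun lam U obs e D P)
    (h0 : ∀ j, obs (starAt 𝒳 𝒴 j) ≠ 0) (h1 : ∀ j, obs (starAt 𝒳 𝒴 j) ≠ 1)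
    (hq : Measurable q) (hqD : ((ν.prod (Measure.pi μ)).withDensity q).map reveal = D 0)
    (j : Fin p)
    (hcl : InL1Closure (P j) (stepSpan U (P j) j)
      (fun w => lam (stepKernel D P j true w).toReal)) :
    InL1Closure (cond (partialLaw ν μ q (stepKernel D P) p) (missing 𝒳 𝒴 j))
      (linkSpan U (partialLaw ν μ q (stepKernel D P) p) j)
      (fun ω => lam (missProb (partialLaw ν μ q (stepKernel D P) p) j ω)) := by
  have hmap := hrun.map_mask_cond_missing ν μ h0 h1 hq hqD j
  refine hcl.comp (measurable_mask j) hmap (fun v hv => ?_) ?_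
  · induction hv using Submodule.span_induction with
    | mem v hv =>
      refine Submodule.subset_span ?_
      rcases hv with ⟨α, hα, rfl⟩ | ⟨u, hu, rfl⟩
      · refine Or.inl ⟨α, ?_, rfl⟩
        rwa [← hmap, Measure.map_map (measurable_erase j) (measurable_mask j)] at hα
      · exact Or.inr ⟨u, hu, funext fun ω => yPart_mask hu.2 ω⟩
    | zero => exact Submodule.zero_mem _
    | add v v' _ _ h h' => exact Submodule.add_mem _ h h'
    | smul c v _ h => exact Submodule.smul_mem _ c h
  · have hac : cond (partialLaw ν μ q (stepKernel D P) p) (missing 𝒳 𝒴 j) ≪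
        partialLaw ν μ q (stepKernel D P) p := cond_absolutelyContinuous
    filter_upwards [hac.ae_le (hrun.missProb_ae_eq ν μ h0 h1 hq hqD j)] with ω hω
    rw [hω]
    rfl

/-- The construction keeps the auxiliary expectations. -/
theorem IsRun.integral_auxiliary (hrun : IsRun lam U obs e D P)
    (h0 : ∀ j, obs (starAt 𝒳 𝒴 j) ≠ 0) (h1 : ∀ j, obs (starAt 𝒳 𝒴 j) ≠ 1) (j : Fin p)
    {u : (∀ i, 𝒴 i) → ℝ} (hu : u ∈ auxFrom U j) :
    Integrable (fun w => u (yPart w)) (D j.castSucc) ∧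
      ∫ w, u (yPart w) ∂(D j.castSucc) = e u := by
  have := (hrun.invariants h0 h1 j.succ).1
  obtain ⟨-, hmix, -⟩ := hrun.mixture_restrict h0 h1 j
  obtain ⟨hui, hue⟩ := (hrun.projection j).1.2.2.2 u hu
  have hu1 := hui.smul_measure (measure_ne_top (D j.succ) (starAt 𝒳 𝒴 j))
  have hu2 := hrun.integrable j u hu
  rw [hmix]
  refine ⟨hu1.add_measure hu2, ?_⟩
  have ha0 : (D j.succ).real (starAt 𝒳 𝒴 j) ≠ 0 :=
    (ENNReal.toReal_pos (by rw [hrun.measure_starAt h0 h1 j]; exact h0 j)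
      (measure_ne_top _ _)).ne'
  -- The expectation imposed given M_j = 1, times π_j, is e u minus the integral over M_j = 0; the
  -- other component of the mixture restores that integral.
  rw [integral_add_measure hu1 hu2, integral_smul_measure, hue, auxMissing, smul_eq_mul]
  change (D j.succ).real (starAt 𝒳 𝒴 j) * _ + _ = _
  rw [mul_div_cancel₀ _ ha0]
  ring

end Output

end SAN

/-! ### The identification theorem -/

theorem theorem4 {p : ℕ} {𝒳 : Type*} {𝒴 : Fin p → Type*}
    [MeasurableSpace 𝒳] [∀ i, MeasurableSpace (𝒴 i)] [∀ i, Nonempty (𝒴 i)]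
    (ν : Measure 𝒳) [SigmaFinite ν] (μ : ∀ i, Measure (𝒴 i)) [∀ i, SigmaFinite (μ i)]
    (h g : SAN.FullData 𝒳 𝒴 → ℝ≥0∞) (hh : SAN.IsFullDataDensity ν μ h)
    (U : Set ((∀ i, 𝒴 i) → ℝ)) (hU : SAN.IsAuxiliaryFamily U (SAN.law ν μ h))
    (π : Fin p → ℝ) (hπ : ∀ j, π j = (SAN.law ν μ h).real (SAN.missing 𝒳 𝒴 j))
    (hπ_pos : ∀ j, 0 < π j) (hπ_lt : ∀ j, π j < 1)
    (lam : ℝ → ℝ) (hlam : SAN.RegularLink lam)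
    (hint : ∀ j, ∀ z > 0,
      IntervalIntegrable (fun v => lam (v / (SAN.odds (π j) + v))) volume 0 z)
    (hgrowth : ∀ j, SAN.GrowthCondition (SAN.linkDiv lam (SAN.odds (π j))))
    (hg : SAN.IsOutput ν μ lam U ((SAN.law ν μ h).map SAN.materialize)
      (fun u => ∫ ω, u ω.2.1 ∂(SAN.law ν μ h)) g) :
    SAN.IsFullDataDensity ν μ g ∧
    (SAN.SequentiallyAdditive lam (SAN.law ν μ g) ∧
      ∀ j, SAN.InL1Closure (ProbabilityTheory.cond (SAN.law ν μ g) (SAN.missing 𝒳 𝒴 j))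
        (SAN.linkSpan U (SAN.law ν μ g) j)
        (fun ω => lam (SAN.missProb (SAN.law ν μ g) j ω))) ∧
    (SAN.ObservationallyEquivalent (SAN.law ν μ g) (SAN.law ν μ h) ∧
      (∀ᵐ ω ∂(SAN.baseMeasure ν μ), SAN.obsDensity μ g ω = SAN.obsDensity μ h ω) ∧
      ∀ u ∈ U, Integrable (fun ω => u ω.2.1) (SAN.law ν μ g) ∧
        ∫ ω, u ω.2.1 ∂(SAN.law ν μ g) = ∫ ω, u ω.2.1 ∂(SAN.law ν μ h)) := by
  obtain ⟨D, P, q, hrun, hq, hqD, hgm, hgq⟩ := hg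
  have hH : IsProbabilityMeasure (SAN.law ν μ h) := ⟨by
    rw [SAN.law, withDensity_apply _ MeasurableSet.univ, Measure.restrict_univ, hh.2]⟩
  have hmat : Measurable (SAN.materialize : SAN.FullData 𝒳 𝒴 → SAN.Materialized 𝒳 𝒴) :=
    SAN.measurable_mask p
  have hobs := Measure.isProbabilityMeasure_map (μ := SAN.law ν μ h) hmat.aemeasurable
  have hstar : ∀ j, (SAN.law ν μ h).map SAN.materialize (SAN.starAt 𝒳 𝒴 j) =
      SAN.law ν μ h (SAN.missing 𝒳 𝒴 j) := fun j => by
    rw [Measure.map_apply hmat (SAN.measurableSet_starAt j)]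
    exact congrArg _ (Set.ext fun ω => SAN.mask_mem_starAt j.2 ω)
  have hreal : ∀ j, ((SAN.law ν μ h).map SAN.materialize).real (SAN.starAt 𝒳 𝒴 j) = π j :=
    fun j => (congrArg ENNReal.toReal (hstar j)).trans (hπ j).symm
  have h0 : ∀ j, (SAN.law ν μ h).map SAN.materialize (SAN.starAt 𝒳 𝒴 j) ≠ 0 := fun j h => by
    have h1 := hreal j
    rw [Measure.real, h, ENNReal.toReal_zero] at h1
    exact (hπ_pos j).ne h1
  have h1 : ∀ j, (SAN.law ν μ h).map SAN.materialize (SAN.starAt 𝒳 𝒴 j) ≠ 1 := fun j h => by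
    have h1 := hreal j
    rw [Measure.real, h, ENNReal.toReal_one] at h1
    exact (hπ_lt j).ne' h1
  -- At stage p every fair coin has been replaced by its kernel.
  have hlaw : SAN.law ν μ g = SAN.partialLaw ν μ q (SAN.stepKernel D P) p := by
    refine withDensity_congr_ae ?_
    filter_upwards [hgq] with ω hω
    simp only [SAN.partialDensity, hω, Fin.is_lt, if_true]
  have hG := hrun.isProbabilityMeasure_output ν μ h0 h1 hq hqD
  have hcl : ∀ j, SAN.InL1Closure (P j) (SAN.stepSpan U (P j) j)
      (fun w => lam (SAN.stepKernel D P j true w).toReal) := fun j =>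
    hrun.inL1Closure_link h0 h1 hlam j (by rw [hreal]; exact hint j)
      (by rw [hreal]; exact hgrowth j)
  have hmask := hrun.map_mask_output ν μ h0 h1 hq hqD
  have hequiv : SAN.ObservationallyEquivalent (SAN.law ν μ g) (SAN.law ν μ h) := by
    have h2 := hmask (Fin.last p)
    rw [hrun.input] at h2
    rw [SAN.ObservationallyEquivalent, hlaw]
    exact h2
  refine ⟨⟨hgm, ?_⟩, ⟨?_, fun j => ?_⟩, hequiv, SAN.obsDensity_ae_eq ν μ hgm hh.1 hequiv,
    fun u hu => ?_⟩
  · have h2 : SAN.law ν μ g Set.univ = 1 := by rw [hlaw, measure_univ]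
    rwa [SAN.law, withDensity_apply _ MeasurableSet.univ, Measure.restrict_univ] at h2
  · rw [hlaw]
    exact hrun.sequentiallyAdditive ν μ h0 h1 hq hqD hcl
  · rw [hlaw]
    exact hrun.inL1Closure_missProb ν μ h0 h1 hq hqD j (hcl j)
  · have hum := (hU.1 u hu).1
    rw [hlaw]
    -- Without coordinates Y is constant. Otherwise every function of y belongs to the family of the
    -- first coordinate, whose step produces `D 0`, the law of (X, Y) under the output.
    rcases p with _ | p
    · have hconst : ∀ ω : SAN.FullData 𝒳 𝒴, u ω.2.1 = u (fun i => i.elim0) := fun ω =>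
        congrArg u (Subsingleton.elim _ _)
      simp only [hconst]
      exact ⟨integrable_const _, by simp⟩
    · have hu0 : u ∈ SAN.auxFrom U (0 : Fin (p + 1)) :=
        ⟨hu, fun y y' hy => congrArg u (funext fun i => hy i (Fin.zero_le i))⟩
      obtain ⟨h2, h3⟩ := hrun.integral_auxiliary h0 h1 0 hu0
      rw [← hmask (Fin.castSucc 0)] at h2 h3
      have h4 : ∀ ω : SAN.FullData 𝒳 𝒴,
          u (SAN.yPart (SAN.mask ((0 : Fin (p + 1)).castSucc : ℕ) ω)) = u ω.2.1 := fun ω =>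
        SAN.yPart_mask (j := 0) hu0.2 ω
      rw [integral_map (f := fun w => u (SAN.yPart w)) (SAN.measurable_mask _).aemeasurable
        (hum.comp SAN.measurable_yPart).aestronglyMeasurable] at h3
      have h5 := h2.comp_measurable (SAN.measurable_mask _)
      simp only [Function.comp_def, h4] at h3 h5
      exact ⟨h5, h3⟩
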